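/- **Model.** Let $N\ge 1$. A single server visits the queues $Q_1,\dots,Q_N$ cyclically; each visit to $Q_i$ is followed by a switch-over period. Each visit and each switch-over period uses fresh copies, independent of each other and of the initial workload, of the following objects. *Visit to $Q_i$.* During the visit the work in the queues evolves as $\boldsymbol z+\boldsymbol A_i(t)$, where $\boldsymbol z$ is the workload vector at the start of the visit and $\boldsymbol A_i=(A_{i,1},\dots,A_{i,N})$ is an $N$-dimensional Lévy process with respect to a filtration $\mathcal F_i$. The $A_{i,j}$, $j\ne i$, are nondecreasing, $A_{i,i}$ has no negative jumps, $\mathbb E|A_{i,j}(1)|<\infty$ for all $j$, and $\mathbb E A_{i,i}(1)<0$. If the server finds work $x\ge 0$ at $Q_i$, the visit lasts $\tau_i(x)$ (jointly measurable in $x$ and the randomness), where for every $x$ * $\tau_i(x)$ is an $\mathcal F_i$-stopping time; * $\tau_i(x)\le T_i(x):=\inf\{t\ge 0: A_{i,i}(t)=-x\}$ a.s. (work conservation). Moreover, it is not the case that $\tau_i(x)=0$ a.s. for all $x$. The discipline is a branching discipline: $\boldsymbol H_i(x):=x\boldsymbol e_i+\boldsymbol A_i(\tau_i(x))$, $x\ge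 0$, is (up to modification) an $N$-dimensional Lévy subordinator in $x$. So a visit changes the workload vector $\boldsymbol z$ into $\boldsymbol z-z_i\boldsymbol e_i+\boldsymbol H_i(z_i)$. *Switch-over period after $Q_i$.* It has a random duration $S_i>0$, and an $N$-dimensional Lévy subordinator $\hat{\boldsymbol W}_i$, independent of $S_i$, feeds the queues; so it adds $\hat{\boldsymbol W}_i(S_i)$ to the workload vector. Let $\boldsymbol B^n\in\mathbb R_+^N$, $n\ge 0$, be the workload vector when the server reaches $Q_1$ for the $n$-th time, where time $0$ counts as the $0$-th and $\boldsymbol B^0$ has an arbitrary law on $\mathbb R_+^N$. Let $\boldsymbol G$ be the workload vector at the end of a cycle that starts with all queues empty. The system is **stable** if there is a probability law on $\mathbb R_+^N$ to which $\boldsymbol B^n$ converges in distribution for every law of $\boldsymbol B^0$. It is **unstable** if $\|\boldsymbol B^n\|\to\infty$ a.s. for every law of $\boldsymbol B^0$. Let $A=(a_{ij})$, $a_{ij}=\mathbb E A_{i,j}(1)$, be the rate matrix, and let $\rho_A$ be its Perron–Frobenius eigenvalue, i.e. the largest real part of an eigenvalue of $A$. **Corollary.** 1. Let $A$ be irreducible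 and suppose that the total work $\sum_i\hat{\boldsymbol W}_i(S_i)$ arriving during the switch-over periods of a cycle is not a.s. $\boldsymbol 0$. * If $\rho_A<0$ and $\mathbb E\|\boldsymbol G\|<\infty$, then the polling system is stable. * If $\rho_A>0$, then the polling system is unstable. 2. Consequently stability does not depend on the disciplines: if two such systems have the same irreducible rate matrix $A$ with $\rho_A\neq0$, and both have switch-over input that is not a.s. $\boldsymbol 0$ and $\mathbb E\|\boldsymbol G\|<\infty$, then one is stable if and only if the other is, and one is unstable if and only if the other is. 3. In the standard model, one input law is used throughout, i.e. for all $i,j$ the process $\boldsymbol A_i(t)+t\boldsymbol e_i$ is a subordinator with the same law as $\hat{\boldsymbol W}_j$, and the server works at unit speed. Let $\rho_j>0$ be the mean rate of the input into $Q_j$ and let $\rho=\sum_j\rho_j$. If $\rho<1$ and $\mathbb E\|\boldsymbol G\|<\infty$, then the system is stable; if $\rho>1$, then it is unstable. -/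

import Mathlib

open MeasureTheory ProbabilityTheory Filter Topology
open scoped NNReal ENNReal

noncomputable section

namespace Polling

/-- An `N`-dimensional Lévy process: it starts at `0`, has stationary independent increments, and
almost surely its paths are right-continuous with left limits. -/
structure IsLevy {N : ℕ} {Ω : Type*} [MeasurableSpace Ω] (P : Measure Ω)
    (X : ℝ≥0 → Ω → (Fin N → ℝ)) : Prop where
  measurable : ∀ t, Measurable (X t)
  zero : ∀ᵐ ω ∂P, X 0 ω = 0
  indep : HasIndepIncrements X P
  stationary : ∀ s t, IdentDistrib (fun ω => X (s + t) ω - X s ω) (X t) P P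
  cadlag : ∀ᵐ ω ∂P, ∀ t,
    ContinuousWithinAt (fun s => X s ω) (Set.Ioi t) t ∧
      ∃ l, Tendsto (fun s => X s ω) (𝓝[<] t) (𝓝 l)

/-- An `N`-dimensional Lévy subordinator: a Lévy process whose paths are almost surely
nondecreasing in every coordinate. -/
structure IsSubordinator {N : ℕ} {Ω : Type*} [MeasurableSpace Ω] (P : Measure Ω)
    (X : ℝ≥0 → Ω → (Fin N → ℝ)) : Prop where
  levy : IsLevy P X
  monotone : ∀ᵐ ω ∂P, Monotone (fun t => X t ω)

/-- `X` is a Lévy process with respect to the filtration `𝓕`: it is a Lévy process, adapted to `𝓕`,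
and its increments after time `s` are independent of `𝓕 s`. -/
structure IsLevyWrt {N : ℕ} {Ω : Type*} [mΩ : MeasurableSpace Ω] (P : Measure Ω)
    (𝓕 : Filtration ℝ≥0 mΩ) (X : ℝ≥0 → Ω → (Fin N → ℝ)) : Prop where
  levy : IsLevy P X
  adapted : ∀ t, Measurable[𝓕 t] (X t)
  indep_past : ∀ s t,
    Indep (MeasurableSpace.comap (fun ω => X (s + t) ω - X s ω) inferInstance) (𝓕 s) P

/-- The first time `T(x) = inf {t ≥ 0 : Y t = -x}` at which a real path `Y` is at level `-x`
(it is `∞` if there is no such time). -/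
def hitTime (Y : ℝ≥0 → ℝ) (x : ℝ≥0) : ℝ≥0∞ :=
  ⨅ (t : ℝ≥0) (_ : Y t = -(x : ℝ)), (t : ℝ≥0∞)

/-- The workload `H(x) = x eᵢ + A(τ(x))` that, at the end of a visit of the server to queue `i`,
replaces the workload `x` found there on arrival. -/
def replacement {N : ℕ} {Ω : Type*} (i : Fin N) (A : ℝ≥0 → Ω → (Fin N → ℝ))
    (τ : ℝ≥0 → Ω → ℝ≥0∞) (x : ℝ≥0) (ω : Ω) : Fin N → ℝ :=
  Pi.single i (x : ℝ) + A (τ x ω).toNNReal ω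

/-- What happens while the server is at queue `i`, on the probability space `(Ω, P)`:
* `A` is the Lévy process that drives the work in the `N` queues during the visit; its coordinates
  `j ≠ i` are input to the queues that are not in service (subordinators), its coordinate `i` is
  spectrally positive with negative drift;
* `τ x` is the duration of the visit if the server finds the amount `x` of work at queue `i`;
  it is a stopping time, work-conserving, and not degenerate;
* the discipline is a branching discipline: the replacement of `x` is, up to modification, a Lévy
  subordinator in the variable `x`. -/
structure Visit (N : ℕ) (i : Fin N) {Ω : Type*} [mΩ : MeasurableSpace Ω] (P : Measure Ω) where
  A : ℝ≥0 → Ω → (Fin N → ℝ)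
  𝓕 : Filtration ℝ≥0 mΩ
  τ : ℝ≥0 → Ω → ℝ≥0∞
  levy : IsLevyWrt P 𝓕 A
  /-- The input to the other queues is nondecreasing. -/
  input_monotone : ∀ᵐ ω ∂P, ∀ j, j ≠ i → Monotone (fun t => A t ω j)
  /-- The work in the queue in service has no negative jumps. -/
  spectrally_positive : ∀ᵐ ω ∂P, ∀ t, 0 < t → ∀ l : ℝ,
    Tendsto (fun s => A s ω i) (𝓝[<] t) (𝓝 l) → l ≤ A t ω i
  /-- The rates `E A_j(1)` exist and are finite. -/
  integrable : ∀ j, Integrable (fun ω => A 1 ω j) P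
  drift_neg : ∫ ω, A 1 ω i ∂P < 0
  measurable_τ : Measurable (fun p : ℝ≥0 × Ω => τ p.1 p.2)
  stopping : ∀ x, IsStoppingTime 𝓕 (τ x)
  work_conserving : ∀ x, ∀ᵐ ω ∂P, τ x ω ≤ hitTime (fun t => A t ω i) x
  /-- The server does serve queue `i`. -/
  nondegenerate : ¬ ∀ x, ∀ᵐ ω ∂P, τ x ω = 0
  branching : ∃ H : ℝ≥0 → Ω → (Fin N → ℝ), IsSubordinator P H ∧
    ∀ x, ∀ᵐ ω ∂P, replacement i A τ x ω = H x ω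

/-- A switch-over period on the probability space `(Ω, P)`: its positive duration `S`, and the
subordinator `W`, independent of `S`, that feeds the queues during this period. -/
structure SwitchOver (N : ℕ) {Ω : Type*} [MeasurableSpace Ω] (P : Measure Ω) where
  W : ℝ≥0 → Ω → (Fin N → ℝ)
  S : Ω → ℝ≥0
  subordinator : IsSubordinator P W
  measurable_S : Measurable S
  S_pos : ∀ᵐ ω ∂P, 0 < S ω
  indep : IndepFun S (fun ω t => W t ω) P

/-- A polling system with `N` queues and varying input. The visits to the different queues and the
switch-over periods after them live on separate probability spaces; the random experiment of a
cycle is the product of all of them, so that they are independent. -/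
structure PollingSystem {N : ℕ} {Ω Ω' : Fin N → Type*} [∀ i, MeasurableSpace (Ω i)]
    [∀ i, MeasurableSpace (Ω' i)] (P : ∀ i, Measure (Ω i)) (P' : ∀ i, Measure (Ω' i)) where
  visit : ∀ i, Visit N i (P i)
  switch : ∀ i, SwitchOver N (P' i)

/-- The probability measure of the random experiment that governs one cycle. -/
def cycleMeasure {N : ℕ} {Ω Ω' : Fin N → Type*} [∀ i, MeasurableSpace (Ω i)]
    [∀ i, MeasurableSpace (Ω' i)] (P : ∀ i, Measure (Ω i)) (P' : ∀ i, Measure (Ω' i)) :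
    Measure (∀ i, Ω i × Ω' i) :=
  Measure.pi fun i => (P i).prod (P' i)

instance {N : ℕ} {Ω Ω' : Fin N → Type*} [∀ i, MeasurableSpace (Ω i)]
    [∀ i, MeasurableSpace (Ω' i)] (P : ∀ i, Measure (Ω i)) (P' : ∀ i, Measure (Ω' i))
    [∀ i, IsProbabilityMeasure (P i)] [∀ i, IsProbabilityMeasure (P' i)] :
    IsProbabilityMeasure (cycleMeasure P P') := by
  unfold cycleMeasure; infer_instance

/-- The probability measure of the whole evolution: an initial workload with law `μ`, and
independently of it a sequence of independent copies of the experiment of a cycle. -/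
def pathMeasure {N : ℕ} {Ω Ω' : Fin N → Type*} [∀ i, MeasurableSpace (Ω i)]
    [∀ i, MeasurableSpace (Ω' i)] (P : ∀ i, Measure (Ω i)) (P' : ∀ i, Measure (Ω' i))
    (μ : Measure (Fin N → ℝ)) : Measure ((Fin N → ℝ) × (ℕ → ∀ i, Ω i × Ω' i)) :=
  μ.prod (Measure.infinitePi fun _ : ℕ => cycleMeasure P P')

instance {N : ℕ} {Ω Ω' : Fin N → Type*} [∀ i, MeasurableSpace (Ω i)]
    [∀ i, MeasurableSpace (Ω' i)] (P : ∀ i, Measure (Ω i)) (P' : ∀ i, Measure (Ω' i))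
    [∀ i, IsProbabilityMeasure (P i)] [∀ i, IsProbabilityMeasure (P' i)]
    (μ : Measure (Fin N → ℝ)) [IsProbabilityMeasure μ] :
    IsProbabilityMeasure (pathMeasure P P' μ) := by
  unfold pathMeasure; infer_instance

namespace PollingSystem

variable {N : ℕ} {Ω Ω' : Fin N → Type*} [∀ i, MeasurableSpace (Ω i)]
  [∀ i, MeasurableSpace (Ω' i)] {P : ∀ i, Measure (Ω i)} {P' : ∀ i, Measure (Ω' i)}

/-- The workload vector at the end of a visit to queue `i`, if it is `z` at the beginning:
`z - zᵢ eᵢ + Hᵢ(zᵢ)`. -/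
def afterVisit (Q : PollingSystem P P') (i : Fin N) (ω : Ω i) (z : Fin N → ℝ) : Fin N → ℝ :=
  z - Pi.single i (z i) + replacement i (Q.visit i).A (Q.visit i).τ (z i).toNNReal ω

/-- The work that arrives during the switch-over period after the visit to queue `i`. -/
def switchInput (Q : PollingSystem P P') (i : Fin N) (ω : Ω' i) : Fin N → ℝ :=
  (Q.switch i).W ((Q.switch i).S ω) ω

/-- The workload vector at the end of a cycle, if it is `z` at the beginning: the queues are visited
in their order, and every visit is followed by a switch-over period. -/
def cycle (Q : PollingSystem P P') (ω : ∀ i, Ω i × Ω' i) (z : Fin N → ℝ) : Fin N → ℝ :=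
  (List.finRange N).foldl
    (fun y i => Q.afterVisit i (ω i).1 y + Q.switchInput i (ω i).2) z

/-- The workload vector `B^n` when the server reaches the first queue for the `n`-th time
(the initial time being counted as the `0`-th). -/
def workload (Q : PollingSystem P P') :
    ℕ → (Fin N → ℝ) × (ℕ → ∀ i, Ω i × Ω' i) → (Fin N → ℝ)
  | 0, p => p.1
  | n + 1, p => Q.cycle (p.2 n) (Q.workload n p)

/-- The rate matrix: its entry `(i, j)` is the rate of the work evolution at queue `j` while the
server is at queue `i`. -/
def rateMatrix (Q : PollingSystem P P') : Matrix (Fin N) (Fin N) ℝ :=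
  Matrix.of fun i j => ∫ ω, (Q.visit i).A 1 ω j ∂(P i)

/-- The total work that arrives during the switch-over periods of a cycle is not almost surely
zero. -/
def NonzeroSwitchInput (Q : PollingSystem P P') : Prop :=
  ¬ ∀ᵐ ω ∂(cycleMeasure P P'), ∑ i, Q.switchInput i (ω i).2 = 0

/-- The work present at the end of a cycle that starts with an empty system (the immigration of
the branching structure) is integrable. -/
def IntegrableImmigration (Q : PollingSystem P P') : Prop :=
  Integrable (fun ω => Q.cycle ω 0) (cycleMeasure P P')

/-- Stability: there is a probability law on the nonnegative vectors to which the workload `B^n`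
converges in distribution, whatever the initial law. -/
def Stable (Q : PollingSystem P P') [∀ i, IsProbabilityMeasure (P i)]
    [∀ i, IsProbabilityMeasure (P' i)] : Prop :=
  ∃ π : ProbabilityMeasure (Fin N → ℝ), (∀ᵐ z ∂(π : Measure (Fin N → ℝ)), 0 ≤ z) ∧
    ∀ μ : ProbabilityMeasure (Fin N → ℝ), (∀ᵐ z ∂(μ : Measure (Fin N → ℝ)), 0 ≤ z) →
      TendstoInDistribution Q.workload atTop (fun z : Fin N → ℝ => z)
        (fun _ => pathMeasure P P' (μ : Measure (Fin N → ℝ))) (π : Measure (Fin N → ℝ))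

/-- Instability: almost surely the workload `B^n` tends to infinity, whatever the initial law. -/
def Unstable (Q : PollingSystem P P') : Prop :=
  ∀ μ : ProbabilityMeasure (Fin N → ℝ), (∀ᵐ z ∂(μ : Measure (Fin N → ℝ)), 0 ≤ z) →
    ∀ᵐ p ∂(pathMeasure P P' (μ : Measure (Fin N → ℝ))),
      Tendsto (fun n => ‖Q.workload n p‖) atTop atTop

/-- The standard model: the input process has the same law during all visits and all switch-over
periods, and the server works at unit speed, so that `A(t) + t eᵢ` is the input process during a
visit to queue `i`. (The law of a Lévy process is determined by its one-dimensional marginals.) -/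
structure IsStandard (Q : PollingSystem P P') : Prop where
  subordinator : ∀ i,
    IsSubordinator (P i) (fun t ω => (Q.visit i).A t ω + Pi.single i (t : ℝ))
  same_law : ∀ i j t,
    IdentDistrib (fun ω => (Q.visit i).A t ω + Pi.single i (t : ℝ)) ((Q.switch j).W t)
      (P i) (P' j)

/-- The mean rate of the input into queue `j`, during the switch-over period after the visit to
queue `j`; in the standard model it is the rate of the input into queue `j` at all times. -/
def inputRate (Q : PollingSystem P P') (j : Fin N) : ℝ :=
  ∫ ω, (Q.switch j).W 1 ω j ∂(P' j)

end PollingSystem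

/-- Irreducibility of a square matrix: there is no nonempty proper subset `s` of the indices with
`A i j = 0` for all `i ∈ s` and `j ∉ s`. -/
def IsIrreducibleMatrix {N : ℕ} (A : Matrix (Fin N) (Fin N) ℝ) : Prop :=
  ∀ s : Set (Fin N), s.Nonempty → sᶜ.Nonempty → ∃ i ∈ s, ∃ j ∈ sᶜ, A i j ≠ 0

/-- The largest real part of a complex eigenvalue of `A`. If the off-diagonal entries of `A` are
nonnegative, this number is itself an eigenvalue, the Perron-Frobenius eigenvalue of `A`. -/
def perronEigenvalue {N : ℕ} (A : Matrix (Fin N) (Fin N) ℝ) : ℝ :=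
  sSup (Complex.re '' spectrum ℂ (A.map (fun a : ℝ => (a : ℂ))))

end Polling

end

set_option linter.unusedSectionVars false

/-! All statements reduce to finding a strictly positive weight vector `v` for which every
coordinate of `A v` has the same strict sign. Irreducibility and `ρ_A > 0` give `A v > 0`
(`exists_pos_mulVec_pos`, started from the absolute values of an eigenvector). If `ρ_A < 0`, then `v
= (-A)⁻¹ 1` is positive and `A v = -1` (`exists_pos_mulVec_neg`). In the standard model `v = 1`
works, since every row of `A` sums to `ρ - 1`.

The link with the visits is Wald's identity (`IsRealLevyWrt.wald`): stopping at `τ_i(x)` moves queue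
`j` by `a_ij E τ_i(x)` in the mean, with the same factor for all `j`. The branching property makes
`E τ_i(x)` additive in `x`, so it equals `c_i x`, with `c_i > 0` (`Visit.exists_mean`). A visit that
finds `x` therefore changes `v · z` by `c_i x (A v)_i` in the mean. The discipline enters only
through the positive constant `c_i`, so it cannot change the sign.

Stability: run two workloads on the same randomness. Subordinators are monotone, so expected
distances are expected replacements, and the `v`-weighted ℓ¹ distance contracts by a factor `θ < 1`
per cycle (`exists_contraction`). The backward iterates started from `0` are then almost surely
Cauchy, the immigration being integrable. They have the one-dimensional laws of the forward
iterates, and the coupling removes the dependence on the initial law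
(`exists_tendstoInDistribution_walk`).

Instability: for small `ε` the function `exp (-ε v · z)` does not increase in the mean during a
visit, for all `x` at once because the Laplace transform of a subordinator is multiplicative in `x`.
Nonzero switch-over input contributes a factor below `1` per cycle. Hence the expectations of `exp
(-ε v · B^n)` are summable for each fixed starting point, and `‖B^n‖ → ∞` (`unstable_of_drift_pos`).

Independence of the discipline follows from this dichotomy, because a stable system is never
unstable. -/

namespace Polling

/-! ### Positive test vectors for matrices with nonnegative off-diagonal entries -/

section Matrix

variable {N : ℕ}

/-- If `t - A` is nonsingular for all `t ≥ 0` and `A` has nonnegative off-diagonal entries, then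
`A` maps some positive vector to a negative one. -/
lemma exists_pos_mulVec_neg [Nonempty (Fin N)] (A : Matrix (Fin N) (Fin N) ℝ)
    (hA : ∀ i j, i ≠ j → 0 ≤ A i j)
    (hdet : ∀ t : ℝ, 0 ≤ t → (t • (1 : Matrix (Fin N) (Fin N) ℝ) - A).det ≠ 0) :
    ∃ v : Fin N → ℝ, (∀ i, 0 < v i) ∧ ∀ i, A.mulVec v i < 0 := by
  -- The resolvent is applied to the all-ones vector. Its minimal coordinate `g t` is positive for
  -- large `t` and can never vanish, so it is still positive at `t = 0`, where `A v = -1`.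
  set B : ℝ → Matrix (Fin N) (Fin N) ℝ := fun t => t • 1 - A with hB
  set v : ℝ → Fin N → ℝ := fun t => (B t)⁻¹.mulVec 1 with hv
  have hBc : Continuous B := by fun_prop
  have hmul : ∀ t, 0 ≤ t → ∀ i, t * v t i - ∑ j, A i j * v t j = 1 := by
    intro t ht i
    have h1 : (B t).mulVec (v t) = 1 := by
      rw [hv, Matrix.mulVec_mulVec, Matrix.mul_nonsing_inv _ (isUnit_iff_ne_zero.2 (hdet t ht)),
        Matrix.one_mulVec]
    have h2 := congrFun h1 i
    rw [hB, Matrix.sub_mulVec, Matrix.smul_mulVec, Matrix.one_mulVec] at h2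
    simpa [Matrix.mulVec, dotProduct] using h2
  have hvc : ∀ i, ContinuousOn (fun t => v t i) (Set.Ici 0) := by
    intro i
    have : ∀ t, v t i = ((B t).det)⁻¹ * ((B t).adjugate.mulVec 1 i) := by
      intro t
      simp [hv, Matrix.inv_def, Matrix.smul_mulVec]
    simp only [this]
    refine ContinuousOn.mul (ContinuousOn.inv₀ hBc.matrix_det.continuousOn
      fun t ht => hdet t ht) ?_
    exact ((continuous_apply i).comp
      (hBc.matrix_adjugate.matrix_mulVec continuous_const)).continuousOn
  set g : ℝ → ℝ := fun t => Finset.univ.inf' Finset.univ_nonempty (fun i => v t i) with hg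
  have hgc : ContinuousOn g (Set.Ici 0) :=
    ContinuousOn.finset_inf'_apply _ fun i _ => hvc i
  -- at a coordinate `i` that attains the minimum
  have key : ∀ t, 0 ≤ t → ∃ i, v t i = g t ∧ 1 ≤ (t - ∑ j, A i j) * g t := by
    intro t ht
    obtain ⟨i, -, hi⟩ := Finset.exists_mem_eq_inf' Finset.univ_nonempty (fun i => v t i)
    refine ⟨i, hi.symm, ?_⟩
    have hle : ∀ j, g t ≤ v t j := fun j => Finset.inf'_le _ (Finset.mem_univ j)
    have h1 := hmul t ht i
    have h2 : ∑ j, A i j * g t ≤ ∑ j, A i j * v t j := by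
      refine Finset.sum_le_sum fun j _ => ?_
      by_cases hij : i = j
      · subst hij
        exact le_of_eq (by rw [← hi])
      · exact mul_le_mul_of_nonneg_left (hle j) (hA i j hij)
    rw [← Finset.sum_mul] at h2
    have : v t i = g t := hi.symm
    rw [this] at h1
    linarith [sub_mul t (∑ j, A i j) (g t)]
  obtain ⟨t₀, ht₀, hgt₀⟩ : ∃ t₀, 0 ≤ t₀ ∧ 0 < g t₀ := by
    -- This `t₀` dominates every row sum, so the factor of `g t₀` in `key` is nonnegative; a product
    -- that is at least `1` then forces `g t₀ > 0`.
    refine ⟨∑ i, |∑ j, A i j|, Finset.sum_nonneg fun _ _ => abs_nonneg _, ?_⟩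
    obtain ⟨i, -, hi⟩ := key (∑ i, |∑ j, A i j|) (Finset.sum_nonneg fun _ _ => abs_nonneg _)
    have : ∑ j, A i j ≤ ∑ i, |∑ j, A i j| := (le_abs_self _).trans
      (Finset.single_le_sum (f := fun i => |∑ j, A i j|) (fun _ _ => abs_nonneg _)
        (Finset.mem_univ i))
    by_contra hneg
    nlinarith
  have hg0 : 0 < g 0 := by
    by_contra hneg
    -- A zero of `g` would turn `key` into `1 ≤ 0`.
    obtain ⟨t, ht, hgt⟩ := intermediate_value_Icc ht₀
      (hgc.mono Set.Icc_subset_Ici_self) ⟨not_lt.1 hneg, hgt₀.le⟩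
    obtain ⟨i, -, hi⟩ := key t ht.1
    rw [hgt] at hi
    linarith
  refine ⟨v 0, fun i => hg0.trans_le (Finset.inf'_le _ (Finset.mem_univ i)), fun i => ?_⟩
  have := hmul 0 le_rfl i
  simp only [Matrix.mulVec, dotProduct]
  linarith

/-- If some nonnegative nonzero vector `u` satisfies `A u ≥ r u` with `r > 0` and `A` is
irreducible with nonnegative off-diagonal entries, then `A` maps some positive vector to a positive
one. -/
lemma exists_pos_mulVec_pos (A : Matrix (Fin N) (Fin N) ℝ)
    (hA : ∀ i j, i ≠ j → 0 ≤ A i j) (hirr : IsIrreducibleMatrix A) {r : ℝ} (hr : 0 < r)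
    (hu : ∃ u : Fin N → ℝ, 0 ≤ u ∧ u ≠ 0 ∧ r • u ≤ A.mulVec u) :
    ∃ v : Fin N → ℝ, (∀ i, 0 < v i) ∧ ∀ i, 0 < A.mulVec v i := by
  classical
  set U : Set (Fin N → ℝ) := {u | 0 ≤ u ∧ u ≠ 0 ∧ r • u ≤ A.mulVec u} with hU
  set supp : (Fin N → ℝ) → Finset (Fin N) := fun u => Finset.univ.filter fun i => u i ≠ 0 with hsupp
  have hfin : (supp '' U).Finite := Set.toFinite _
  -- Take a subinvariant vector of maximal support. If the support were not everything,
  -- irreducibility would allow it to be enlarged.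
  obtain ⟨s, ⟨u, huU, rfl⟩, hmax⟩ := hfin.exists_maximalFor Finset.card _ (Set.Nonempty.image supp hu)
  obtain ⟨hu0, hune, hru⟩ := huU
  have hpos : ∀ i, 0 < u i := by
    by_contra! hcon
    obtain ⟨i₀, hi₀⟩ := hcon
    have hi₀' : u i₀ = 0 := le_antisymm hi₀ (hu0 i₀)
    obtain ⟨k, hk⟩ : ∃ k, u k ≠ 0 := by
      by_contra! h
      exact hune (funext h)
    obtain ⟨i, hi, j, hj, hij⟩ := hirr {i | u i = 0} ⟨i₀, hi₀'⟩ ⟨k, hk⟩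
    -- The shift makes `B = A + c` nonnegative with diagonal at least `1`. As `B` commutes with `A`,
    -- it preserves subinvariance; its diagonal keeps the old support, and the entry `(i, j)` found
    -- above adds the new point `i`.
    set c : ℝ := 1 + ∑ i, |A i i| with hc
    set B : Matrix (Fin N) (Fin N) ℝ := A + c • 1 with hB
    have hc1 : ∀ i, 1 ≤ A i i + c := by
      intro i
      have := Finset.single_le_sum (f := fun i => |A i i|) (fun _ _ => abs_nonneg _)
        (Finset.mem_univ i)
      have h2 := neg_abs_le (A i i)
      linarith
    have hBnn : ∀ i j, 0 ≤ B i j := by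
      intro i j
      by_cases h : i = j
      · subst h
        have := hc1 i
        simp [hB]
        linarith
      · simpa [hB, Matrix.one_apply_ne h] using hA i j h
    have hBmono : ∀ w : Fin N → ℝ, 0 ≤ w → 0 ≤ B.mulVec w := fun w hw i => by
      simp only [Matrix.mulVec, dotProduct]
      exact Finset.sum_nonneg fun j _ => mul_nonneg (hBnn i j) (hw j)
    set u' := B.mulVec u with hu'
    have hge : ∀ l, u l ≤ u' l := by
      intro l
      have h1 : B l l * u l ≤ u' l :=
        Finset.single_le_sum (f := fun j => B l j * u j)
          (fun j _ => mul_nonneg (hBnn l j) (hu0 j)) (Finset.mem_univ l)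
      have h2 : 1 ≤ B l l := by simpa [hB] using hc1 l
      exact (le_mul_of_one_le_left (hu0 l) h2).trans h1
    have hu'U : u' ∈ U := by
      refine ⟨hBmono u hu0, fun h => hk (le_antisymm ?_ (hu0 k)), ?_⟩
      · simpa [h] using hge k
      · have h1 : A.mulVec u' = B.mulVec (A.mulVec u) := by
          rw [hu', Matrix.mulVec_mulVec, Matrix.mulVec_mulVec, hB, Matrix.mul_add, Matrix.add_mul]
          simp
        have h2 := hBmono _ (sub_nonneg.2 hru)
        rw [Matrix.mulVec_sub, Matrix.mulVec_smul] at h2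
        rw [h1]
        exact sub_nonneg.1 h2
    have hsub : supp u ⊂ supp u' := by
      refine Finset.ssubset_iff_subset_ne.2 ⟨fun l hl => ?_, fun heq => ?_⟩
      · simp only [hsupp, Finset.mem_filter, Finset.mem_univ, true_and] at hl ⊢
        have : 0 < u l := lt_of_le_of_ne (hu0 l) (Ne.symm hl)
        exact (this.trans_le (hge l)).ne'
      · have hi' : i ∉ supp u := by simpa [hsupp] using hi
        apply hi'
        rw [heq]
        simp only [hsupp, Finset.mem_filter, Finset.mem_univ, true_and]
        have hne : i ≠ j := by
          rintro rfl
          exact hj hi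
        have h1 : B i j * u j ≤ u' i :=
          Finset.single_le_sum (f := fun j => B i j * u j)
            (fun j _ => mul_nonneg (hBnn i j) (hu0 j)) (Finset.mem_univ j)
        have h2 : B i j = A i j := by simp [hB, Matrix.one_apply_ne hne]
        have h3 : 0 < A i j := lt_of_le_of_ne (hA i j hne) (Ne.symm hij)
        have h4 : 0 < u j := lt_of_le_of_ne (hu0 j) (Ne.symm hj)
        rw [h2] at h1
        exact ((mul_pos h3 h4).trans_le h1).ne'
    have hlt := Finset.card_lt_card hsub
    have := hmax ⟨u', hu'U, rfl⟩ hlt.le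
    omega
  exact ⟨u, hpos, fun i => (mul_pos hr (hpos i)).trans_le (hru i)⟩

/-- The absolute value of a complex eigenvector is a nonnegative subinvariant vector. -/
lemma exists_subinvariant_of_mem_spectrum (A : Matrix (Fin N) (Fin N) ℝ)
    (hA : ∀ i j, i ≠ j → 0 ≤ A i j) {μ : ℂ}
    (hμ : μ ∈ spectrum ℂ (A.map (fun a : ℝ => (a : ℂ)))) :
    ∃ u : Fin N → ℝ, 0 ≤ u ∧ u ≠ 0 ∧ μ.re • u ≤ A.mulVec u := by
  rw [spectrum.mem_iff, Matrix.isUnit_iff_isUnit_det, isUnit_iff_ne_zero, not_not] at hμ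
  obtain ⟨w, hw0, hw⟩ := Matrix.exists_mulVec_eq_zero_iff.2 hμ
  refine ⟨fun i => ‖w i‖, fun i => norm_nonneg _, fun h => hw0 ?_, fun i => ?_⟩
  · ext i
    simpa using congrFun h i
  have h1 : μ * w i = ∑ j, (A i j : ℂ) * w j := by
    have h2 := congrFun hw i
    rw [Matrix.sub_mulVec, Algebra.algebraMap_eq_smul_one, Matrix.smul_mulVec,
      Matrix.one_mulVec] at h2
    have h3 := sub_eq_zero.1 h2
    simpa [Matrix.mulVec, dotProduct] using h3
  -- The diagonal term is moved to the left before taking absolute values, since `A i i` may be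
  -- negative. Then `μ.re - A i i ≤ ‖μ - A i i‖` suffices.
  have h2 : (μ - A i i) * w i = ∑ j ∈ Finset.univ.erase i, (A i j : ℂ) * w j := by
    rw [sub_mul, h1, ← Finset.add_sum_erase _ _ (Finset.mem_univ i)]
    ring
  have h3 : (μ.re - A i i) * ‖w i‖ ≤ ∑ j ∈ Finset.univ.erase i, A i j * ‖w j‖ := by
    calc (μ.re - A i i) * ‖w i‖ ≤ ‖μ - A i i‖ * ‖w i‖ := by
          refine mul_le_mul_of_nonneg_right ?_ (norm_nonneg _)
          have := (le_abs_self _).trans (Complex.abs_re_le_norm (μ - A i i))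
          simpa using this
      _ = ‖∑ j ∈ Finset.univ.erase i, (A i j : ℂ) * w j‖ := by rw [← norm_mul, h2]
      _ ≤ ∑ j ∈ Finset.univ.erase i, ‖(A i j : ℂ) * w j‖ := norm_sum_le _ _
      _ = ∑ j ∈ Finset.univ.erase i, A i j * ‖w j‖ := by
          refine Finset.sum_congr rfl fun j hj => ?_
          rw [norm_mul, Complex.norm_real, Real.norm_of_nonneg]
          exact hA i j (Finset.ne_of_mem_erase hj).symm
  have h4 : A.mulVec (fun i => ‖w i‖) i = A i i * ‖w i‖
      + ∑ j ∈ Finset.univ.erase i, A i j * ‖w j‖ := by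
    rw [Finset.add_sum_erase Finset.univ (fun j => A i j * ‖w j‖) (Finset.mem_univ i)]
    rfl
  rw [h4]
  simp only [Pi.smul_apply, smul_eq_mul]
  linarith

lemma exists_pos_mulVec_neg_of_perronEigenvalue_neg [Nonempty (Fin N)]
    (A : Matrix (Fin N) (Fin N) ℝ) (hA : ∀ i j, i ≠ j → 0 ≤ A i j) (h : perronEigenvalue A < 0) :
    ∃ v : Fin N → ℝ, (∀ i, 0 < v i) ∧ ∀ i, A.mulVec v i < 0 := by
  refine exists_pos_mulVec_neg A hA fun t ht hdet => ?_
  have hmem : (t : ℂ) ∈ spectrum ℂ (A.map (fun a : ℝ => (a : ℂ))) := by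
    rw [spectrum.mem_iff, Matrix.isUnit_iff_isUnit_det, isUnit_iff_ne_zero, not_not]
    have : algebraMap ℂ (Matrix (Fin N) (Fin N) ℂ) (t : ℂ) - A.map (fun a : ℝ => (a : ℂ))
        = (Complex.ofRealHom).mapMatrix (t • (1 : Matrix (Fin N) (Fin N) ℝ) - A) := by
      ext i j
      by_cases hij : i = j
      · subst hij
        simp [Matrix.algebraMap_matrix_apply]
      · simp [Matrix.algebraMap_matrix_apply, hij]
    rw [this, ← RingHom.map_det, hdet, map_zero]
  have hbdd : BddAbove (Complex.re '' spectrum ℂ (A.map (fun a : ℝ => (a : ℂ)))) := by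
    refine Set.Finite.bddAbove (Set.Finite.image _ ?_)
    exact Matrix.finite_spectrum _
  have := le_csSup hbdd ⟨_, hmem, rfl⟩
  rw [Complex.ofReal_re] at this
  exact absurd h (not_lt.2 (ht.trans this))

lemma exists_pos_mulVec_pos_of_perronEigenvalue_pos
    (A : Matrix (Fin N) (Fin N) ℝ) (hA : ∀ i j, i ≠ j → 0 ≤ A i j) (hirr : IsIrreducibleMatrix A)
    (h : 0 < perronEigenvalue A) :
    ∃ v : Fin N → ℝ, (∀ i, 0 < v i) ∧ ∀ i, 0 < A.mulVec v i := by
  obtain ⟨_, ⟨μ, hμ, rfl⟩, hpos⟩ :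
      ∃ x ∈ Complex.re '' spectrum ℂ (A.map (fun a : ℝ => (a : ℂ))), 0 < x := by
    -- `Real.sSup_nonpos` also covers the empty set, whose supremum is `0` by convention.
    by_contra! hcon
    exact absurd h (not_lt.2 (Real.sSup_nonpos hcon))
  exact exists_pos_mulVec_pos A hA hirr hpos (exists_subinvariant_of_mem_spectrum A hA hμ)

end Matrix

end Polling

/-! ### Wald's identity: the process on a grid -/

namespace Polling

/-- A real-valued right-continuous process with stationary increments that are independent of the
past, as described by the filtration `𝓕`. -/
structure IsRealLevyWrt {Ω : Type*} [mΩ : MeasurableSpace Ω] (P : Measure Ω)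
    (𝓕 : Filtration ℝ≥0 mΩ) (Y : ℝ≥0 → Ω → ℝ) : Prop where
  adapted : ∀ t, Measurable[𝓕 t] (Y t)
  zero : ∀ᵐ ω ∂P, Y 0 ω = 0
  rightCont : ∀ᵐ ω ∂P, ∀ t, ContinuousWithinAt (fun s => Y s ω) (Set.Ioi t) t
  indep : ∀ s t, Indep (𝓕 s) (MeasurableSpace.comap (fun ω => Y (s + t) ω - Y s ω) inferInstance) P
  stationary : ∀ s t, IdentDistrib (fun ω => Y (s + t) ω - Y s ω) (Y t) P P

lemma measurable_of_countable_choice {Ω E : Type*} [MeasurableSpace Ω] [MeasurableSpace E]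
    {f : ℕ → Ω → E} (hf : ∀ n, Measurable (f n)) {κ : Ω → ℕ} (hκ : Measurable κ) :
    Measurable fun ω => f (κ ω) ω := by
  have h1 : Measurable fun p : ℕ × Ω => f p.1 p.2 := measurable_from_prod_countable_right hf
  exact h1.comp (hκ.prodMk measurable_id)

namespace IsRealLevyWrt

variable {Ω : Type*} [mΩ : MeasurableSpace Ω] {P : Measure Ω} [IsProbabilityMeasure P]
  {𝓕 : Filtration ℝ≥0 mΩ} {Y : ℝ≥0 → Ω → ℝ}

lemma measurable (h : IsRealLevyWrt P 𝓕 Y) (t : ℝ≥0) : Measurable (Y t) :=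
  (h.adapted t).mono (𝓕.le t) le_rfl

lemma setIntegral_comp (h : IsRealLevyWrt P 𝓕 Y) (s t : ℝ≥0) {G : Set Ω}
    (hG : MeasurableSet[𝓕 s] G) {f : ℝ → ℝ} (hf : Measurable f) :
    ∫ ω in G, f (Y (s + t) ω - Y s ω) ∂P = P.real G * ∫ ω, f (Y t ω) ∂P := by
  rw [Indep.setIntegral_eq_mul (𝓕.le s) (h.indep s t)
    ((h.measurable _).sub (h.measurable _)).aemeasurable hG hf.aestronglyMeasurable]
  congr 1
  exact ((h.stationary s t).comp hf).integral_eq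

/-- The times at which the process is integrable with mean `a t`. -/
def IsMeanTime (P : Measure Ω) (Y : ℝ≥0 → Ω → ℝ) (a : ℝ) (t : ℝ≥0) : Prop :=
  Integrable (Y t) P ∧ ∫ ω, Y t ω ∂P = a * t

lemma integrable_increment (h : IsRealLevyWrt P 𝓕 Y) (s : ℝ≥0) {t : ℝ≥0}
    (ht : Integrable (Y t) P) : Integrable (fun ω => Y (s + t) ω - Y s ω) P :=
  (h.stationary s t).integrable_iff.2 ht

lemma isMeanTime_add (h : IsRealLevyWrt P 𝓕 Y) {a : ℝ} {s t : ℝ≥0} (hs : IsMeanTime P Y a s)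
    (ht : IsMeanTime P Y a t) : IsMeanTime P Y a (s + t) := by
  have h1 := h.integrable_increment s ht.1
  have h2 : Y (s + t) = fun ω => Y s ω + (Y (s + t) ω - Y s ω) := by ext; ring
  refine ⟨?_, ?_⟩
  · rw [h2]
    exact hs.1.add h1
  · rw [h2, integral_add hs.1 h1, hs.2, (h.stationary s t).integral_eq, ht.2]
    push_cast
    ring

lemma isMeanTime_zero (h : IsRealLevyWrt P 𝓕 Y) (a : ℝ) : IsMeanTime P Y a 0 := by
  have h0 : Y 0 =ᵐ[P] 0 := h.zero
  exact ⟨(integrable_congr h0).2 (integrable_zero _ _ _), by rw [integral_congr_ae h0]; simp⟩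

lemma isMeanTime_nsmul (h : IsRealLevyWrt P 𝓕 Y) {a : ℝ} {t : ℝ≥0} (ht : IsMeanTime P Y a t)
    (n : ℕ) : IsMeanTime P Y a (n * t) := by
  induction n with
  | zero => simpa using h.isMeanTime_zero a
  | succ n ih =>
    have := h.isMeanTime_add ih ht
    convert this using 1
    push_cast
    ring

/-- If a sum of two independent variables is integrable, Fubini makes each of them integrable. This
descends from time `1`, the only time at which integrability is assumed, to the dyadic meshes. -/
lemma isMeanTime_half (h : IsRealLevyWrt P 𝓕 Y) {a : ℝ} {t : ℝ≥0}
    (ht : IsMeanTime P Y a (t + t)) : IsMeanTime P Y a t := by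
  set X' : Ω → ℝ := fun ω => Y (t + t) ω - Y t ω with hX'
  have hX'm : Measurable X' := (h.measurable _).sub (h.measurable _)
  have hind : IndepFun (Y t) X' P :=
    indep_of_indep_of_le_left (h.indep t t) (h.adapted t).comap_le
  have hint : Integrable (Y t) P := by
    have hmap := hind.map_prod_eq_prod_map_map (h.measurable t).aemeasurable hX'm.aemeasurable
    have h1 : Integrable (fun p : ℝ × ℝ => p.1 + p.2) ((P.map (Y t)).prod (P.map X')) := by
      rw [← hmap, integrable_map_measure (by fun_prop)
        ((h.measurable t).prodMk hX'm).aemeasurable]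
      refine ht.1.congr (Eventually.of_forall fun ω => ?_)
      simp [hX']
    have : IsProbabilityMeasure (P.map X') := Measure.isProbabilityMeasure_map hX'm.aemeasurable
    have : IsProbabilityMeasure (P.map (Y t)) :=
      Measure.isProbabilityMeasure_map (h.measurable t).aemeasurable
    obtain ⟨y, hy⟩ := h1.prod_left_ae.exists
    have h2 : Integrable (fun x : ℝ => x) (P.map (Y t)) := by
      refine (hy.sub (integrable_const y)).congr (Eventually.of_forall fun x => ?_)
      simp
    rw [integrable_map_measure (by fun_prop) (h.measurable t).aemeasurable] at h2
    exact h2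
  refine ⟨hint, ?_⟩
  have h2 : Y (t + t) = fun ω => Y t ω + (Y (t + t) ω - Y t ω) := by ext; ring
  have h3 := ht.2
  rw [h2, integral_add hint (h.integrable_increment t hint),
    (h.stationary t t).integral_eq] at h3
  push_cast at h3
  linarith

lemma isMeanTime_dyadic (h : IsRealLevyWrt P 𝓕 Y) {a : ℝ} (h1 : IsMeanTime P Y a 1) (n : ℕ) :
    IsMeanTime P Y a ((2 ^ n)⁻¹) := by
  induction n with
  | zero => simpa using h1
  | succ n ih =>
    apply h.isMeanTime_half
    convert ih using 1
    rw [pow_succ, mul_inv, ← mul_add, ← two_mul, mul_inv_cancel₀ two_ne_zero, mul_one]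

/-- The number of the grid interval of mesh `δ` that contains `τ`, plus one. -/
noncomputable def gridIndex (τ : Ω → ℝ≥0∞) (δ : ℝ≥0) (ω : Ω) : ℕ := ⌊(τ ω).toNNReal / δ⌋₊ + 1

/-- The compensated process at the first grid point after `τ`. -/
noncomputable def gridValue (Y : ℝ≥0 → Ω → ℝ) (a : ℝ) (τ : Ω → ℝ≥0∞) (δ : ℝ≥0) (ω : Ω) : ℝ :=
  Y (gridIndex τ δ ω * δ) ω - a * (gridIndex τ δ ω * δ)

lemma measurable_gridIndex {τ : Ω → ℝ≥0∞} (hτ : Measurable τ) (δ : ℝ≥0) :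
    Measurable (gridIndex τ δ) := by
  unfold gridIndex
  exact (Nat.measurable_floor.comp (hτ.ennreal_toNNReal.div_const δ)).add_const 1

lemma measurable_gridValue (h : IsRealLevyWrt P 𝓕 Y) (a : ℝ) {τ : Ω → ℝ≥0∞} (hτ : Measurable τ)
    (δ : ℝ≥0) : Measurable (gridValue Y a τ δ) :=
  measurable_of_countable_choice (f := fun n ω => Y (n * δ) ω - a * (n * δ))
    (fun n => (h.measurable (n * δ)).sub_const (a * (n * δ))) (measurable_gridIndex hτ δ)

/-- The grid point used lies strictly after `τ`, even when `τ` is on the grid. Whether the `k`-th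
step is taken is thus decided by `k * δ ≤ τ`, an event known at time `k * δ`. -/
lemma lt_gridIndex_iff {τ : Ω → ℝ≥0∞} {δ : ℝ≥0} (hδ : 0 < δ) {ω : Ω} (hω : τ ω ≠ ∞) (k : ℕ) :
    k < gridIndex τ δ ω ↔ ((k * δ : ℝ≥0) : ℝ≥0∞) ≤ τ ω := by
  rw [gridIndex, Nat.lt_succ_iff, Nat.le_floor_iff zero_le, le_div_iff₀ hδ]
  conv_rhs => rw [← ENNReal.coe_toNNReal hω]
  exact ENNReal.coe_le_coe.symm

lemma tsum_measure_grid_le {τ : Ω → ℝ≥0∞} (hτ : Measurable τ) {δ : ℝ≥0} (hδ : 0 < δ) :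
    ∑' k : ℕ, P {ω | ((k * δ : ℝ≥0) : ℝ≥0∞) ≤ τ ω} ≤ ∫⁻ ω, (τ ω / δ + 1) ∂P := by
  have hm : ∀ k : ℕ, MeasurableSet {ω | ((k * δ : ℝ≥0) : ℝ≥0∞) ≤ τ ω} :=
    fun k => measurableSet_le measurable_const hτ
  calc ∑' k : ℕ, P {ω | ((k * δ : ℝ≥0) : ℝ≥0∞) ≤ τ ω}
      = ∑' k : ℕ, ∫⁻ ω, {ω | ((k * δ : ℝ≥0) : ℝ≥0∞) ≤ τ ω}.indicator 1 ω ∂P := by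
        simp_rw [lintegral_indicator_one (hm _)]
    _ = ∫⁻ ω, ∑' k : ℕ, {ω | ((k * δ : ℝ≥0) : ℝ≥0∞) ≤ τ ω}.indicator 1 ω ∂P :=
        (lintegral_tsum fun k => (measurable_one.indicator (hm k)).aemeasurable).symm
    _ ≤ ∫⁻ ω, (τ ω / δ + 1) ∂P := by
        refine lintegral_mono fun ω => ?_
        by_cases hω : τ ω = ∞
        · simp [hω, ENNReal.top_div_of_ne_top]
        have h1 : ∑' k : ℕ, {ω | ((k * δ : ℝ≥0) : ℝ≥0∞) ≤ τ ω}.indicator (1 : Ω → ℝ≥0∞) ω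
            = ∑ k ∈ Finset.range (gridIndex τ δ ω), 1 := by
          rw [tsum_eq_sum (s := Finset.range (gridIndex τ δ ω))]
          · refine Finset.sum_congr rfl fun k hk => ?_
            have := (lt_gridIndex_iff hδ hω k).1 (Finset.mem_range.1 hk)
            exact Set.indicator_of_mem (s := {ω | ((k * δ : ℝ≥0) : ℝ≥0∞) ≤ τ ω}) this 1
          · intro k hk
            refine Set.indicator_of_notMem (fun hmem => hk ?_) _
            exact Finset.mem_range.2 ((lt_gridIndex_iff hδ hω k).2 hmem)
        rw [h1]
        simp only [Finset.sum_const, Finset.card_range, nsmul_eq_mul, mul_one]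
        rw [gridIndex]
        push_cast
        gcongr
        conv_rhs => rw [← ENNReal.coe_toNNReal hω]
        rw [← ENNReal.coe_div hδ.ne', ← ENNReal.coe_natCast]
        exact ENNReal.coe_le_coe.2 (Nat.floor_le zero_le)

/-- The discrete Wald identity. The value is the sum over `k` of the compensated increments on `k *
δ ≤ τ`; each is independent of that event and centered, and the norms are summable because the
probabilities add up to at most `E τ / δ + 1`. -/
lemma gridValue_integrable (h : IsRealLevyWrt P 𝓕 Y) {a : ℝ} {δ : ℝ≥0} (hδ : 0 < δ)
    (hmean : IsMeanTime P Y a δ) {τ : Ω → ℝ≥0∞} (hτ : Measurable τ)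
    (hstp : IsStoppingTime 𝓕 τ) (hfin : ∫⁻ ω, τ ω ∂P ≠ ∞) :
    Integrable (gridValue Y a τ δ) P ∧ ∫ ω, gridValue Y a τ δ ω ∂P = 0 := by
  set E : ℕ → Set Ω := fun k => {ω | ((k * δ : ℝ≥0) : ℝ≥0∞) ≤ τ ω} with hE
  have hEF : ∀ k : ℕ, MeasurableSet[𝓕 (k * δ)] (E k) := fun k => hstp.measurableSet_ge (k * δ)
  have hEm : ∀ k, MeasurableSet (E k) := fun k => 𝓕.le _ _ (hEF k)
  set d : ℕ → Ω → ℝ := fun k ω => (Y (k * δ + δ) ω - Y (k * δ) ω) - a * δ with hd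
  have hdint : ∀ k, Integrable (d k) P := fun k =>
    (h.integrable_increment _ hmean.1).sub (integrable_const _)
  set F : ℕ → Ω → ℝ := fun k => (E k).indicator (d k) with hF
  have hFint : ∀ k, Integrable (F k) P := fun k => (hdint k).indicator (hEm k)
  have hFnorm : ∀ k, ∫ ω, ‖F k ω‖ ∂P = P.real (E k) * ∫ ω, |Y δ ω - a * δ| ∂P := by
    intro k
    simp_rw [hF, norm_indicator_eq_indicator_norm]
    rw [integral_indicator (hEm k)]
    exact h.setIntegral_comp (k * δ) δ (hEF k) (f := fun x => |x - a * δ|) (by fun_prop)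
  have hFzero : ∀ k, ∫ ω, F k ω ∂P = 0 := by
    intro k
    simp_rw [hF]
    rw [integral_indicator (hEm k)]
    have := h.setIntegral_comp (k * δ) δ (hEF k) (f := fun x => x - a * δ) (by fun_prop)
    rw [integral_sub hmean.1 (integrable_const _), hmean.2] at this
    simpa using this
  have hsum : Summable fun k => ∫ ω, ‖F k ω‖ ∂P := by
    simp_rw [hFnorm]
    refine Summable.mul_right _ (ENNReal.summable_toReal (ne_top_of_le_ne_top ?_
      (tsum_measure_grid_le hτ hδ)))
    rw [lintegral_add_right _ measurable_const]
    simp only [div_eq_mul_inv]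
    rw [lintegral_mul_const _ hτ]
    refine ENNReal.add_ne_top.2 ⟨ENNReal.mul_ne_top hfin ?_, by simp⟩
    simp [hδ.ne']
  have hae : ∀ᵐ ω ∂P, τ ω ≠ ∞ := (ae_lt_top hτ hfin).mono fun _ h => h.ne
  have hZ : (fun ω => ∑' k, F k ω) =ᵐ[P] gridValue Y a τ δ := by
    filter_upwards [hae, h.zero] with ω hω h0
    rw [tsum_eq_sum (s := Finset.range (gridIndex τ δ ω))]
    · have h1 : ∀ k ∈ Finset.range (gridIndex τ δ ω), F k ω
          = (Y ((k + 1 : ℕ) * δ) ω - a * ((k + 1 : ℕ) * δ)) - (Y (k * δ) ω - a * (k * δ)) := by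
        intro k hk
        have hmem : ω ∈ E k := (lt_gridIndex_iff hδ hω k).1 (Finset.mem_range.1 hk)
        rw [hF]
        simp only
        rw [Set.indicator_of_mem hmem]
        have : (((k + 1 : ℕ) : ℝ≥0) * δ) = k * δ + δ := by push_cast; ring
        rw [hd, this]
        push_cast
        ring
      rw [Finset.sum_congr rfl h1,
        Finset.sum_range_sub (fun k : ℕ => Y (k * δ) ω - a * (k * δ))]
      simp [h0, gridValue]
    · intro k hk
      refine Set.indicator_of_notMem (fun hmem => hk ?_) _
      exact Finset.mem_range.2 ((lt_gridIndex_iff hδ hω k).2 hmem)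
  constructor
  · refine Integrable.congr ⟨?_, ?_⟩ hZ
    · exact (h.measurable_gridValue a hτ δ).aestronglyMeasurable.congr hZ.symm
    · refine lt_of_le_of_lt (lintegral_mono fun ω => enorm_tsum_le_tsum_enorm) ?_
      rw [lintegral_tsum fun k => (hFint k).aestronglyMeasurable.enorm]
      simp_rw [← ofReal_integral_norm_eq_lintegral_enorm (hFint _)]
      exact hsum.tsum_ofReal_lt_top
  · rw [← integral_congr_ae hZ, ← integral_tsum_of_summable_integral_norm hFint hsum]
    simp [hFzero]

end IsRealLevyWrt

end Polling

/-! ### Wald's identity: refinement of the grid -/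

namespace Polling

namespace IsRealLevyWrt

variable {Ω : Type*} [mΩ : MeasurableSpace Ω] {P : Measure Ω} [IsProbabilityMeasure P]
  {𝓕 : Filtration ℝ≥0 mΩ} {Y : ℝ≥0 → Ω → ℝ}

/-- The event that `τ` lies in the `j`-th interval of the grid of mesh `δ`. -/
def gridEvent (τ : Ω → ℝ≥0∞) (δ : ℝ≥0) (j : ℕ) : Set Ω :=
  {ω | ((j * δ : ℝ≥0) : ℝ≥0∞) ≤ τ ω ∧ τ ω < (((j + 1 : ℕ) * δ : ℝ≥0) : ℝ≥0∞)}

lemma measurableSet_gridEvent {τ : Ω → ℝ≥0∞} (hstp : IsStoppingTime 𝓕 τ) (δ : ℝ≥0) (j : ℕ) :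
    MeasurableSet[𝓕 ((j + 1 : ℕ) * δ)] (gridEvent τ δ j) := by
  have h1 : MeasurableSet[𝓕 (j * δ)] {ω | ((j * δ : ℝ≥0) : ℝ≥0∞) ≤ τ ω} :=
    hstp.measurableSet_ge _
  have h2 : MeasurableSet[𝓕 ((j + 1 : ℕ) * δ)] {ω | τ ω < (((j + 1 : ℕ) * δ : ℝ≥0) : ℝ≥0∞)} :=
    hstp.measurableSet_lt _
  have hle : (j * δ : ℝ≥0) ≤ (j + 1 : ℕ) * δ := by gcongr; omega
  exact (𝓕.mono hle _ h1).inter h2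

lemma gridIndex_eq {τ : Ω → ℝ≥0∞} {δ : ℝ≥0} (hδ : 0 < δ) {j : ℕ} {ω : Ω}
    (hω : ω ∈ gridEvent τ δ j) : gridIndex τ δ ω = j + 1 := by
  have hfin : τ ω ≠ ∞ := (lt_top_of_lt hω.2).ne
  have h1 := (lt_gridIndex_iff hδ hfin j).2 hω.1
  have h2 := mt (lt_gridIndex_iff hδ hfin (j + 1)).1 (not_le.2 hω.2)
  omega

lemma mem_gridEvent {τ : Ω → ℝ≥0∞} {δ : ℝ≥0} (hδ : 0 < δ) {ω : Ω} (hω : τ ω ≠ ∞) :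
    ω ∈ gridEvent τ δ (gridIndex τ δ ω - 1) := by
  have h0 : 0 < gridIndex τ δ ω := Nat.succ_pos _
  refine ⟨(lt_gridIndex_iff hδ hω _).1 (by omega), ?_⟩
  rw [Nat.sub_add_cancel h0]
  exact not_le.1 (mt (lt_gridIndex_iff hδ hω _).2 (lt_irrefl _))

/-- The events that are known at the first grid point after `τ`. -/
@[reducible] def gridSigma {τ : Ω → ℝ≥0∞} (hstp : IsStoppingTime 𝓕 τ) (δ : ℝ≥0) : MeasurableSpace Ω where
  MeasurableSet' G :=
    MeasurableSet G ∧ ∀ j : ℕ, MeasurableSet[𝓕 ((j + 1 : ℕ) * δ)] (G ∩ gridEvent τ δ j)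
  measurableSet_empty := ⟨MeasurableSet.empty, fun j => by simp⟩
  measurableSet_compl G hG := by
    refine ⟨hG.1.compl, fun j => ?_⟩
    have : Gᶜ ∩ gridEvent τ δ j = gridEvent τ δ j \ (G ∩ gridEvent τ δ j) := by
      ext ω
      simp only [Set.mem_inter_iff, Set.mem_compl_iff, Set.mem_sdiff]
      tauto
    rw [this]
    exact (measurableSet_gridEvent hstp δ j).diff (hG.2 j)
  measurableSet_iUnion f hf := by
    refine ⟨MeasurableSet.iUnion fun i => (hf i).1, fun j => ?_⟩
    rw [Set.iUnion_inter]
    exact MeasurableSet.iUnion fun i => (hf i).2 j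

lemma gridSigma_le {τ : Ω → ℝ≥0∞} (hstp : IsStoppingTime 𝓕 τ) (δ : ℝ≥0) :
    gridSigma hstp δ ≤ mΩ := fun _ hG => hG.1

lemma measurable_gridValue_gridSigma (h : IsRealLevyWrt P 𝓕 Y) (a : ℝ) {τ : Ω → ℝ≥0∞}
    (hτ : Measurable τ) (hstp : IsStoppingTime 𝓕 τ) {δ : ℝ≥0} (hδ : 0 < δ) :
    Measurable[gridSigma hstp δ] (gridValue Y a τ δ) := by
  intro B hB
  refine ⟨h.measurable_gridValue a hτ δ hB, fun j => ?_⟩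
  have : gridValue Y a τ δ ⁻¹' B ∩ gridEvent τ δ j
      = (fun ω => Y ((j + 1 : ℕ) * δ) ω - a * ((j + 1 : ℕ) * δ)) ⁻¹' B ∩ gridEvent τ δ j := by
    ext ω
    simp only [Set.mem_inter_iff, Set.mem_preimage]
    refine and_congr_left fun hω => ?_
    rw [gridValue, gridIndex_eq hδ hω]
  rw [this]
  exact (((h.adapted _).sub_const _) hB).inter (measurableSet_gridEvent hstp δ j)

/-- This identifies the value on the fine grid as the conditional expectation of the value on the
integer grid. On each fine interval the two differ by a centered increment over a deterministic
time, independent of what is known at the fine grid point. -/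
lemma setIntegral_gridValue (h : IsRealLevyWrt P 𝓕 Y) {a : ℝ} {δ : ℝ≥0} (hδ : 0 < δ)
    (hmean : IsMeanTime P Y a δ) {M : ℕ} (hM : M * δ = 1) {τ : Ω → ℝ≥0∞} (hτ : Measurable τ)
    (hstp : IsStoppingTime 𝓕 τ) (hfin : ∫⁻ ω, τ ω ∂P ≠ ∞) {G : Set Ω}
    (hG : MeasurableSet[gridSigma hstp δ] G) :
    ∫ ω in G, gridValue Y a τ δ ω ∂P = ∫ ω in G, gridValue Y a τ 1 ω ∂P := by
  have hMpos : 0 < M := by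
    rcases Nat.eq_zero_or_pos M with h0 | h0
    · simp [h0] at hM
    · exact h0
  have hmean1 : IsMeanTime P Y a 1 := hM ▸ h.isMeanTime_nsmul hmean M
  have hae : ∀ᵐ ω ∂P, τ ω ≠ ∞ := (ae_lt_top hτ hfin).mono fun _ h => h.ne
  have hint1 := (h.gridValue_integrable hδ hmean hτ hstp hfin).1
  have hint2 := (h.gridValue_integrable one_pos hmean1 hτ hstp hfin).1
  rw [eq_comm, ← sub_eq_zero, ← integral_sub hint2.integrableOn hint1.integrableOn]
  set D : Ω → ℝ := fun ω => gridValue Y a τ 1 ω - gridValue Y a τ δ ω with hD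
  have hDint : Integrable D P := hint2.sub hint1
  set U : ℕ → Set Ω := fun j => G ∩ gridEvent τ δ j with hU
  have hUm : ∀ j, MeasurableSet (U j) := fun j => 𝓕.le _ _ (hG.2 j)
  have hUG : (⋃ j, U j : Set Ω) =ᵐ[P] G := by
    filter_upwards [hae] with ω hω
    refine propext ⟨fun hmem => ?_, fun hmem => ?_⟩
    · obtain ⟨j, hj⟩ := Set.mem_iUnion.1 hmem
      exact hj.1
    · exact Set.mem_iUnion.2 ⟨_, hmem, mem_gridEvent hδ hω⟩
  have hdisj : Pairwise (Function.onFun Disjoint U) := by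
    intro i j hij
    refine Set.disjoint_left.2 fun ω hi hj => hij ?_
    have h1 := gridIndex_eq hδ hi.2
    have h2 := gridIndex_eq hδ hj.2
    omega
  have hsum := hasSum_integral_iUnion hUm hdisj hDint.integrableOn
  rw [setIntegral_congr_set hUG] at hsum
  refine hsum.unique ?_
  convert hasSum_zero with j
  -- The number of steps of size `δ` from the fine grid point `(j + 1) * δ` to the next integer grid
  -- point; `j / M` is the integer part of `τ`.
  set m : ℕ := (j / M + 1) * M - (j + 1) with hm
  have hle : j + 1 ≤ (j / M + 1) * M := by
    have := Nat.lt_div_mul_add hMpos (a := j)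
    rw [add_mul, one_mul]
    omega
  have htime : ((j / M + 1 : ℕ) : ℝ≥0) = (j + 1 : ℕ) * δ + m * δ := by
    rw [← add_mul, ← Nat.cast_add, hm, Nat.add_sub_cancel' hle, Nat.cast_mul, mul_assoc, hM,
      mul_one]
  have hDeq : Set.EqOn D (fun ω => (Y ((j + 1 : ℕ) * δ + m * δ) ω - Y ((j + 1 : ℕ) * δ) ω)
      - a * (m * δ)) (U j) := by
    intro ω hω
    have hidx := gridIndex_eq hδ hω.2
    have hidx1 : gridIndex τ 1 ω = j / M + 1 := by
      have hj : ⌊(τ ω).toNNReal / δ⌋₊ = j := by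
        have := hidx
        unfold gridIndex at this
        omega
      rw [gridIndex, ← hj, ← Nat.floor_div_natCast, div_div, mul_comm δ, hM]
    simp only [hD, gridValue, hidx, hidx1]
    rw [mul_one, htime]
    have htime' : ((j / M + 1 : ℕ) : ℝ) = (j + 1 : ℕ) * (δ : ℝ) + m * δ := by
      exact_mod_cast congrArg ((↑) : ℝ≥0 → ℝ) htime
    rw [htime']
    push_cast
    ring
  rw [setIntegral_congr_fun (hUm j) hDeq]
  have := h.setIntegral_comp ((j + 1 : ℕ) * δ) (m * δ) (hG.2 j) (f := fun x => x - a * (m * δ))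
    (by fun_prop)
  have hmm := h.isMeanTime_nsmul hmean m
  rw [integral_sub hmm.1 (integrable_const _), hmm.2] at this
  simpa using this

/-- **Wald's identity** for a stopping time with finite mean. -/
theorem wald (h : IsRealLevyWrt P 𝓕 Y) {a : ℝ} (hmean : IsMeanTime P Y a 1)
    {τ : Ω → ℝ≥0∞} (hτ : Measurable τ) (hstp : IsStoppingTime 𝓕 τ) (hfin : ∫⁻ ω, τ ω ∂P ≠ ∞) :
    Integrable (fun ω => Y (τ ω).toNNReal ω) P ∧
      ∫ ω, Y (τ ω).toNNReal ω ∂P = a * ∫ ω, (τ ω).toReal ∂P := by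
  set δ : ℕ → ℝ≥0 := fun n => (2 ^ n)⁻¹ with hδdef
  have hδ : ∀ n, 0 < δ n := fun n => by positivity
  set Z : ℕ → Ω → ℝ := fun n => gridValue Y a τ (δ n) with hZ
  have hδmean : ∀ n, IsMeanTime P Y a (δ n) := h.isMeanTime_dyadic hmean
  have hZint := fun n => h.gridValue_integrable (hδ n) (hδmean n) hτ hstp hfin
  have hint1 := (h.gridValue_integrable one_pos hmean hτ hstp hfin).1
  have hcond : ∀ n, P[gridValue Y a τ 1 | gridSigma hstp (δ n)] =ᵐ[P] Z n := by
    intro n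
    refine (ae_eq_condExp_of_forall_setIntegral_eq (gridSigma_le hstp _) hint1
      (fun s _ _ => (hZint n).1.integrableOn) (fun s hs _ => ?_)
      (h.measurable_gridValue_gridSigma a hτ hstp (hδ n)).aestronglyMeasurable).symm
    refine h.setIntegral_gridValue (hδ n) (hδmean n) (M := 2 ^ n) ?_ hτ hstp hfin hs
    simp [hδdef]
  -- All `Z n` are conditional expectations of one integrable variable. This replaces a dominating
  -- function in the limit `n → ∞`.
  have hUI : UniformIntegrable Z 1 P :=
    (hint1.uniformIntegrable_condExp fun n => gridSigma_le hstp (δ n)).ae_eq hcond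
  set W : Ω → ℝ := fun ω => Y (τ ω).toNNReal ω - a * (τ ω).toReal with hW
  have hae : ∀ᵐ ω ∂P, τ ω ≠ ∞ := (ae_lt_top hτ hfin).mono fun _ h => h.ne
  -- The grid points converge to `τ` strictly from the right, so right-continuity of the paths is
  -- enough.
  have hlim : ∀ᵐ ω ∂P, Tendsto (fun n => Z n ω) atTop (𝓝 (W ω)) := by
    filter_upwards [hae, h.rightCont] with ω hω hc
    set σ : ℝ≥0 := (τ ω).toNNReal with hσ
    have hgt : ∀ n, σ < gridIndex τ (δ n) ω * δ n := by
      intro n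
      rw [← div_lt_iff₀ (hδ n), gridIndex]
      push_cast
      exact Nat.lt_floor_add_one _
    have hle : ∀ n, (gridIndex τ (δ n) ω * δ n : ℝ≥0) ≤ σ + δ n := by
      intro n
      rw [gridIndex]
      push_cast
      rw [add_mul, one_mul]
      gcongr
      rw [← le_div_iff₀ (hδ n)]
      exact Nat.floor_le zero_le
    have hδ0 : Tendsto δ atTop (𝓝 0) := by
      have := tendsto_pow_atTop_nhds_zero_of_lt_one (r := (2⁻¹ : ℝ≥0)) (by simp)
        (by rw [← NNReal.coe_lt_coe]; norm_num)
      simpa [hδdef, inv_pow] using this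
    have ht : Tendsto (fun n => (gridIndex τ (δ n) ω * δ n : ℝ≥0)) atTop (𝓝 σ) := by
      refine tendsto_of_tendsto_of_tendsto_of_le_of_le tendsto_const_nhds ?_
        (fun n => (hgt n).le) hle
      simpa using tendsto_const_nhds.add hδ0
    have ht' : Tendsto (fun n => (gridIndex τ (δ n) ω * δ n : ℝ≥0)) atTop (𝓝[>] σ) :=
      tendsto_nhdsWithin_iff.2 ⟨ht, Eventually.of_forall hgt⟩
    have h1 := (hc σ).tendsto.comp ht'
    have h2 : Tendsto (fun n => a * (gridIndex τ (δ n) ω * δ n : ℝ)) atTop (𝓝 (a * σ)) := by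
      refine Tendsto.const_mul a ?_
      have := (NNReal.tendsto_coe.2 ht)
      simpa using this
    exact h1.sub h2
  have hWm : AEStronglyMeasurable W P := aestronglyMeasurable_of_tendsto_ae atTop
    (fun n => (hZint n).1.aestronglyMeasurable) hlim
  have hWint : Integrable W P := by
    obtain ⟨C, hC⟩ := hUI.2.2
    refine memLp_one_iff_integrable.1 ⟨hWm, ?_⟩
    exact (Lp.eLpNorm_le_of_ae_tendsto (Eventually.of_forall hC)
      (fun n => (hZint n).1.aestronglyMeasurable) hlim).trans_lt ENNReal.coe_lt_top
  have hL1 := tendsto_Lp_finite_of_tendsto_ae le_rfl ENNReal.one_ne_top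
    (fun n => (hZint n).1.aestronglyMeasurable) (memLp_one_iff_integrable.2 hWint) hUI.2.1 hlim
  have hlimint := tendsto_integral_of_L1' W hWm (Eventually.of_forall fun n => (hZint n).1) hL1
  have hW0 : ∫ ω, W ω ∂P = 0 := by
    refine tendsto_nhds_unique hlimint ?_
    simp only [fun n => (hZint n).2]
    exact tendsto_const_nhds
  have hτint : Integrable (fun ω => (τ ω).toReal) P :=
    integrable_toReal_of_lintegral_ne_top hτ.aemeasurable hfin
  have hYeq : (fun ω => Y (τ ω).toNNReal ω) = fun ω => W ω + a * (τ ω).toReal := by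
    ext ω
    simp [hW]
  rw [hYeq]
  refine ⟨hWint.add (hτint.const_mul a), ?_⟩
  rw [integral_add hWint (hτint.const_mul a), hW0, integral_const_mul, zero_add]

end IsRealLevyWrt

end Polling

/-! ### Mean effect of a visit -/

namespace Polling

/-- A path without negative jumps stays at or above level `-x` until it hits this level. -/
lemma neg_le_of_le_hitTime {Y : ℝ≥0 → ℝ} (h0 : Y 0 = 0)
    (hright : ∀ t, ContinuousWithinAt Y (Set.Ioi t) t)
    (hleft : ∀ t, ∃ l, Tendsto Y (𝓝[<] t) (𝓝 l))
    (hjump : ∀ t, 0 < t → ∀ l : ℝ, Tendsto Y (𝓝[<] t) (𝓝 l) → l ≤ Y t) {x s : ℝ≥0}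
    (hs : (s : ℝ≥0∞) ≤ hitTime Y x) : -(x : ℝ) ≤ Y s := by
  by_contra! hlt
  set S : Set ℝ≥0 := {u | Y u < -(x : ℝ)} with hS
  have hSne : S.Nonempty := ⟨s, hlt⟩
  set u₀ := sInf S with hu₀
  -- At the infimum `u₀` of the times below `-x`, right-continuity gives `Y u₀ ≤ -x`. If `u₀ > 0`,
  -- the left limit is at least `-x` and there is no downward jump, so the level is hit exactly at
  -- `u₀`. Then `s = u₀`, which contradicts `Y s < -x`.
  have hbefore : ∀ u < u₀, -(x : ℝ) ≤ Y u := fun u hu =>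
    not_lt.1 fun h => absurd (csInf_le (OrderBot.bddBelow S) h) (not_le.2 hu)
  have hle : Y u₀ ≤ -(x : ℝ) := by
    by_contra! hgt
    have hev : ∀ᶠ u in 𝓝[>] u₀, -(x : ℝ) < Y u :=
      (hright u₀).tendsto.eventually (lt_mem_nhds hgt)
    obtain ⟨b, hb, hsub⟩ := (mem_nhdsGT_iff_exists_Ioo_subset).1 hev
    have : b ≤ u₀ := by
      refine le_csInf hSne fun u hu => ?_
      by_contra! hub
      have h1 : u₀ ≤ u := csInf_le (OrderBot.bddBelow S) hu
      rcases h1.eq_or_lt with h2 | h2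
      · rw [h2] at hgt
        exact absurd hu (not_lt.2 hgt.le)
      · have hgt' : -(x : ℝ) < Y u := hsub ⟨h2, hub⟩
        exact absurd hu (not_lt.2 hgt'.le)
    exact absurd hb (not_lt.2 this)
  have hhit : ∀ u, Y u = -(x : ℝ) → s ≤ u := fun u hu => by
    have h1 : hitTime Y x ≤ u := iInf₂_le u hu
    exact_mod_cast hs.trans h1
  rcases eq_zero_or_pos u₀ with hz | hpos
  · rw [hz, h0] at hle
    have hx : x = 0 := by
      have : (x : ℝ) ≤ 0 := by linarith
      exact le_antisymm (by exact_mod_cast this) zero_le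
    have := hhit 0 (by simp [h0, hx])
    have hs0 : s = 0 := le_antisymm this zero_le
    rw [hs0, h0, hx] at hlt
    simp at hlt
  · obtain ⟨l, hl⟩ := hleft u₀
    have hne : (𝓝[<] u₀).NeBot := nhdsLT_neBot_of_exists_lt ⟨0, hpos⟩
    have h1 : -(x : ℝ) ≤ l :=
      ge_of_tendsto hl (eventually_nhdsWithin_of_forall fun u hu => hbefore u hu)
    have h2 := hjump u₀ hpos l hl
    have h3 : s ≤ u₀ := hhit u₀ (le_antisymm hle (h1.trans h2))
    have h4 : u₀ ≤ s := csInf_le (OrderBot.bddBelow S) hlt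
    rw [le_antisymm h3 h4] at hlt
    linarith

/-- A nonnegative additive function on the half-line is linear. -/
lemma eq_mul_of_additive {T : ℝ≥0 → ℝ} (hT : ∀ x, 0 ≤ T x) (hadd : ∀ x y, T (x + y) = T x + T y)
    (x : ℝ≥0) : T x = T 1 * x := by
  have hmono : Monotone T := fun a b hab => by
    obtain ⟨d, rfl⟩ := exists_add_of_le hab
    rw [hadd]
    linarith [hT d]
  have hnat : ∀ (n : ℕ) (y : ℝ≥0), T (n * y) = n * T y := by
    intro n y
    induction n with
    | zero =>
      have := hadd 0 0
      simp only [add_zero] at this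
      simp
      linarith
    | succ n ih =>
      push_cast
      rw [add_mul, one_mul, hadd, ih]
      ring
  -- Monotonicity places `n * T x = T (n * x)` between `⌊n * x⌋ * T 1` and `(⌊n * x⌋ + 1) * T 1`.
  have hkey : ∀ n : ℕ, n * |T x - T 1 * x| ≤ T 1 := by
    intro n
    have h1 := hnat n x
    have hf1 := Nat.floor_le (show (0 : ℝ≥0) ≤ n * x from zero_le)
    have hf2 := (Nat.lt_floor_add_one (n * x : ℝ≥0)).le
    have h2 := hmono hf1
    have h3 := hmono hf2
    have h4 : T (⌊(n * x : ℝ≥0)⌋₊ : ℝ≥0) = ⌊(n * x : ℝ≥0)⌋₊ * T 1 := by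
      have := hnat ⌊(n * x : ℝ≥0)⌋₊ 1
      rwa [mul_one] at this
    rw [hadd, h4, h1] at h3
    rw [h4, h1] at h2
    have hf1' : ((⌊(n * x : ℝ≥0)⌋₊ : ℕ) : ℝ) ≤ n * x := by exact_mod_cast hf1
    have hf2' : (n : ℝ) * x ≤ (⌊(n * x : ℝ≥0)⌋₊ : ℕ) + 1 := by exact_mod_cast hf2
    have h5 := mul_le_mul_of_nonneg_right hf1' (hT 1)
    have h6 := mul_le_mul_of_nonneg_right hf2' (hT 1)
    rw [← Nat.abs_cast, ← abs_mul, abs_le]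
    constructor <;> nlinarith
  by_contra hne
  have hpos : 0 < |T x - T 1 * x| := abs_pos.2 (sub_ne_zero.2 hne)
  obtain ⟨n, hn⟩ := exists_nat_gt (T 1 / |T x - T 1 * x|)
  rw [div_lt_iff₀ hpos] at hn
  exact absurd (hkey n) (not_le.2 hn)

namespace Visit

variable {N : ℕ} {i : Fin N} {Ω : Type*} [mΩ : MeasurableSpace Ω] {P : Measure Ω}
  [IsProbabilityMeasure P]

/-- The mean rate of the work evolution at queue `j` during a visit. -/
noncomputable def rate (V : Visit N i P) (j : Fin N) : ℝ := ∫ ω, V.A 1 ω j ∂P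

lemma isRealLevyWrt (V : Visit N i P) (j : Fin N) :
    IsRealLevyWrt P V.𝓕 (fun t ω => V.A t ω j) where
  adapted t := (measurable_pi_apply j).comp (V.levy.adapted t)
  zero := by
    filter_upwards [V.levy.levy.zero] with ω hω
    simp [hω]
  rightCont := by
    filter_upwards [V.levy.levy.cadlag] with ω hω t
    exact (continuous_apply j).continuousAt.comp_continuousWithinAt (hω t).1
  indep s t := by
    refine indep_of_indep_of_le_right (V.levy.indep_past s t).symm ?_
    have : (fun ω => V.A (s + t) ω j - V.A s ω j)
        = (fun z : Fin N → ℝ => z j) ∘ fun ω => V.A (s + t) ω - V.A s ω := rfl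
    rw [this, ← MeasurableSpace.comap_comp]
    exact MeasurableSpace.comap_mono (measurable_pi_apply j).comap_le
  stationary s t := (V.levy.levy.stationary s t).comp (measurable_pi_apply j)

lemma isMeanTime_one (V : Visit N i P) (j : Fin N) :
    IsRealLevyWrt.IsMeanTime P (fun t ω => V.A t ω j) (V.rate j) 1 :=
  ⟨V.integrable j, by simp [rate]⟩

lemma measurable_τ' (V : Visit N i P) (x : ℝ≥0) : Measurable (V.τ x) :=
  V.measurable_τ.comp (measurable_const.prodMk measurable_id)

lemma rate_nonneg (V : Visit N i P) {j : Fin N} (hj : j ≠ i) : 0 ≤ V.rate j := by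
  refine integral_nonneg_of_ae ?_
  filter_upwards [V.input_monotone, V.levy.levy.zero] with ω hmono h0
  have := hmono j hj (zero_le : (0 : ℝ≥0) ≤ 1)
  simpa [h0] using this

lemma neg_le_A (V : Visit N i P) (x : ℝ≥0) :
    ∀ᵐ ω ∂P, ∀ s : ℝ≥0, (s : ℝ≥0∞) ≤ V.τ x ω → -(x : ℝ) ≤ V.A s ω i := by
  filter_upwards [V.levy.levy.cadlag, V.levy.levy.zero, V.spectrally_positive,
    V.work_conserving x] with ω hc h0 hsp hwc s hs
  refine neg_le_of_le_hitTime (Y := fun t => V.A t ω i) (by simp [h0])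
    (fun t => (continuous_apply i).continuousAt.comp_continuousWithinAt (hc t).1)
    (fun t => ?_) hsp (hs.trans hwc)
  obtain ⟨l, hl⟩ := (hc t).2
  exact ⟨l i, ((continuous_apply i).tendsto l).comp hl⟩

/-- Before the visit ends the served queue has not lost more than `x`. Wald at the bounded time `min
τ n` therefore gives `-x ≤ a_ii E (min τ n)`, and the negative drift bounds the expectations
uniformly in `n`. -/
lemma lintegral_τ_ne_top (V : Visit N i P) (x : ℝ≥0) : ∫⁻ ω, V.τ x ω ∂P ≠ ∞ := by
  have hbound : ∀ n : ℕ, ∫⁻ ω, min (V.τ x ω) (n : ℝ≥0) ∂P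
      ≤ ENNReal.ofReal (x / (-V.rate i)) := by
    intro n
    have hstp : IsStoppingTime V.𝓕 (fun ω => min (V.τ x ω) ((n : ℝ≥0) : ℝ≥0∞)) :=
      (V.stopping x).min_const (n : ℝ≥0)
    have hm : Measurable (fun ω => min (V.τ x ω) ((n : ℝ≥0) : ℝ≥0∞)) :=
      (V.measurable_τ' x).min measurable_const
    have hfin : ∫⁻ ω, min (V.τ x ω) ((n : ℝ≥0) : ℝ≥0∞) ∂P ≠ ∞ := by
      refine ne_top_of_le_ne_top ?_ (lintegral_mono fun ω => min_le_right _ _)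
      simp
    obtain ⟨h1, h2⟩ := (V.isRealLevyWrt i).wald (V.isMeanTime_one i) hm hstp hfin
    have h3 : -(x : ℝ) ≤ V.rate i * ∫ ω, (min (V.τ x ω) ((n : ℝ≥0) : ℝ≥0∞)).toReal ∂P := by
      rw [← h2]
      have : ∫ _, -(x : ℝ) ∂P = -x := by simp
      rw [← this]
      refine integral_mono_ae (integrable_const _) h1 ?_
      filter_upwards [V.neg_le_A x] with ω hω
      refine hω _ ?_
      rw [ENNReal.coe_toNNReal (ne_top_of_le_ne_top ENNReal.coe_ne_top (min_le_right _ _))]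
      exact min_le_left _ _
    have hrate : V.rate i < 0 := V.drift_neg
    refine (ENNReal.le_ofReal_iff_toReal_le hfin (div_nonneg x.2 (by linarith))).2 ?_
    rw [← integral_toReal hm.aemeasurable (ae_lt_top hm hfin), le_div_iff₀ (by linarith), mul_comm,
      neg_mul]
    exact neg_le.1 h3
  have hsup : ∫⁻ ω, V.τ x ω ∂P = ⨆ n : ℕ, ∫⁻ ω, min (V.τ x ω) ((n : ℝ≥0) : ℝ≥0∞) ∂P := by
    rw [← lintegral_iSup (fun n => (V.measurable_τ' x).min measurable_const)]
    · refine lintegral_congr fun ω => ?_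
      refine le_antisymm ?_ (iSup_le fun n => min_le_left _ _)
      by_cases hω : V.τ x ω = ∞
      · rw [hω]
        simp [ENNReal.iSup_natCast]
      · obtain ⟨n, hn⟩ := ENNReal.exists_nat_gt hω
        refine le_iSup_of_le n ?_
        rw [ENNReal.coe_natCast, min_eq_left hn.le]
    · intro m n hmn ω
      exact min_le_min_left _ (ENNReal.coe_le_coe.2 (Nat.cast_le.2 hmn))
  rw [hsup]
  exact ne_top_of_le_ne_top ENNReal.ofReal_ne_top (iSup_le hbound)

lemma integrable_replacement (V : Visit N i P) (x : ℝ≥0) (j : Fin N) :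
    Integrable (fun ω => replacement i V.A V.τ x ω j) P ∧
      ∫ ω, replacement i V.A V.τ x ω j ∂P
        = (Pi.single i (x : ℝ) : Fin N → ℝ) j + V.rate j * ∫ ω, (V.τ x ω).toReal ∂P := by
  obtain ⟨h1, h2⟩ := (V.isRealLevyWrt j).wald (V.isMeanTime_one j) (V.measurable_τ' x)
    (V.stopping x) (V.lintegral_τ_ne_top x)
  simp only [replacement, Pi.add_apply]
  refine ⟨(integrable_const _).add h1, ?_⟩
  rw [integral_add (integrable_const _) h1, h2]
  simp

/-- The mean duration of a visit is proportional to the work found by the server, with a positive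
factor; this determines the means of the replacement. -/
theorem exists_mean (V : Visit N i P) : ∃ c : ℝ, 0 < c ∧ ∀ (x : ℝ≥0) (j : Fin N),
    ∫ ω, replacement i V.A V.τ x ω j ∂P
      = (Pi.single i (x : ℝ) : Fin N → ℝ) j + V.rate j * (c * x) := by
  set T : ℝ≥0 → ℝ := fun x => ∫ ω, (V.τ x ω).toReal ∂P with hT
  have hTnn : ∀ x, 0 ≤ T x := fun x => integral_nonneg fun _ => ENNReal.toReal_nonneg
  have hrate : V.rate i < 0 := V.drift_neg
  obtain ⟨H, hH, hHeq⟩ := V.branching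
  have hmean : ∀ x : ℝ≥0, Integrable (fun ω => H x ω i) P ∧
      ∫ ω, H x ω i ∂P = x + V.rate i * T x := by
    intro x
    have hae : (fun ω => replacement i V.A V.τ x ω i) =ᵐ[P] fun ω => H x ω i := by
      filter_upwards [hHeq x] with ω hω
      rw [hω]
    obtain ⟨h1, h2⟩ := V.integrable_replacement x i
    refine ⟨h1.congr hae, ?_⟩
    rw [← integral_congr_ae hae, h2]
    simp [hT]
  -- Stationary increments of the replacement make `x + a_ii T x` additive; since `a_ii ≠ 0`, so is
  -- `T`.
  have hadd : ∀ x y, T (x + y) = T x + T y := by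
    intro x y
    have h1 : IdentDistrib (fun ω => H (x + y) ω i - H x ω i) (fun ω => H y ω i) P P :=
      (hH.levy.stationary x y).comp (measurable_pi_apply i)
    have h2 := h1.integral_eq
    rw [integral_sub (hmean (x + y)).1 (hmean x).1, (hmean (x + y)).2, (hmean x).2,
      (hmean y).2] at h2
    push_cast at h2
    have h3 : V.rate i * (T (x + y) - (T x + T y)) = 0 := by linarith
    rcases mul_eq_zero.1 h3 with h4 | h4
    · exact absurd h4 hrate.ne
    · linarith
  have hlin := eq_mul_of_additive hTnn hadd
  -- `T 1 = 0` would force `T x = 0`, hence `τ x = 0` almost surely, for every `x`; nondegeneracy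
  -- excludes this.
  refine ⟨T 1, lt_of_le_of_ne (hTnn 1) fun h0 => ?_, fun x j => ?_⟩
  · apply V.nondegenerate
    intro x
    have hx : T x = 0 := by rw [hlin, ← h0, zero_mul]
    rw [hT] at hx
    simp only at hx
    rw [integral_eq_zero_iff_of_nonneg (fun _ => ENNReal.toReal_nonneg)
      (integrable_toReal_of_lintegral_ne_top (V.measurable_τ' x).aemeasurable
        (V.lintegral_τ_ne_top x))] at hx
    filter_upwards [hx, ae_lt_top (V.measurable_τ' x) (V.lintegral_τ_ne_top x)] with ω h1 h2
    exact ((ENNReal.toReal_eq_zero_iff _).1 h1).resolve_right h2.ne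
  · rw [(V.integrable_replacement x j).2, ← hlin]

end Visit

end Polling

/-! ### Exponential estimates for subordinators and visits -/

namespace Polling

namespace IsSubordinator

variable {N : ℕ} {Ω : Type*} [mΩ : MeasurableSpace Ω] {P : Measure Ω}
  {H : ℝ≥0 → Ω → (Fin N → ℝ)}

lemma nonneg (hH : IsSubordinator P H) : ∀ᵐ ω ∂P, ∀ x, 0 ≤ H x ω := by
  filter_upwards [hH.monotone, hH.levy.zero] with ω h1 h2 x
  rw [← h2]
  exact h1 zero_le

lemma indepFun_increment (hH : IsSubordinator P H) (x y : ℝ≥0) :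
    IndepFun (H x) (fun ω => H (x + y) ω - H x ω) P := by
  have h1 := hH.levy.indep 2 ![0, x, x + y] (by
    intro a b hab
    fin_cases a <;> fin_cases b <;> simp_all)
  have h2 := h1.indepFun (i := 0) (j := 1) (by simp)
  refine h2.congr ?_ ?_
  · filter_upwards [hH.levy.zero] with ω hω
    simp [hω]
  · exact Eventually.of_forall fun ω => by simp

/-- The Laplace transform of a subordinator, exponentially tilted by `b`. -/
noncomputable def tiltedLaplace (P : Measure Ω) (H : ℝ≥0 → Ω → (Fin N → ℝ)) (w : Fin N → ℝ)
    (b : ℝ) (x : ℝ≥0) : ℝ≥0∞ :=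
  ∫⁻ ω, ENNReal.ofReal (Real.exp (b * x - ∑ j, w j * H x ω j)) ∂P

lemma tiltedLaplace_add (hH : IsSubordinator P H) (w : Fin N → ℝ) (b : ℝ) (x y : ℝ≥0) :
    tiltedLaplace P H w b (x + y) = tiltedLaplace P H w b x * tiltedLaplace P H w b y := by
  set f : ℝ≥0 → (Fin N → ℝ) → ℝ≥0∞ := fun x z =>
    ENNReal.ofReal (Real.exp (b * x - ∑ j, w j * z j)) with hf
  have hfm : ∀ x, Measurable (f x) := fun x => by fun_prop
  have h1 : tiltedLaplace P H w b y = ∫⁻ ω, f y (H (x + y) ω - H x ω) ∂P :=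
    (((hH.levy.stationary x y).comp (hfm y)).lintegral_eq).symm
  have hm : Measurable (fun ω => H (x + y) ω - H x ω) :=
    (hH.levy.measurable _).sub (hH.levy.measurable _)
  have h2 := lintegral_mul_eq_lintegral_mul_lintegral_of_indepFun
    ((hfm x).comp (hH.levy.measurable x)) ((hfm y).comp hm)
    ((hH.indepFun_increment x y).comp (hfm x) (hfm y))
  rw [h1]
  refine Eq.trans (lintegral_congr fun ω => ?_) h2
  simp only [Pi.mul_apply, Function.comp_apply, hf, Pi.sub_apply]
  rw [← ENNReal.ofReal_mul (Real.exp_nonneg _), ← Real.exp_add]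
  congr 2
  simp only [mul_sub, Finset.sum_sub_distrib]
  push_cast
  ring

lemma tiltedLaplace_natCast_mul (hH : IsSubordinator P H) [IsProbabilityMeasure P]
    (w : Fin N → ℝ) (b : ℝ) (n : ℕ) (x : ℝ≥0) :
    tiltedLaplace P H w b (n * x) = tiltedLaplace P H w b x ^ n := by
  induction n with
  | zero =>
    have : ∫⁻ ω, ENNReal.ofReal (Real.exp (b * (0 : ℝ≥0) - ∑ j, w j * H 0 ω j)) ∂P
        = ∫⁻ _, 1 ∂P := by
      refine lintegral_congr_ae ?_
      filter_upwards [hH.levy.zero] with ω hω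
      simp [hω]
    rw [Nat.cast_zero, zero_mul, pow_zero, tiltedLaplace, this]
    simp
  | succ n ih =>
    push_cast
    rw [add_mul, one_mul, hH.tiltedLaplace_add, ih, pow_succ]

lemma tiltedLaplace_le_mul (hH : IsSubordinator P H) {w : Fin N → ℝ} (hw : ∀ j, 0 ≤ w j)
    (b : ℝ) {x y : ℝ≥0} (hxy : x ≤ y) : tiltedLaplace P H w b y
      ≤ ENNReal.ofReal (Real.exp (b * (y - x))) * tiltedLaplace P H w b x := by
  rw [tiltedLaplace, tiltedLaplace, ← lintegral_const_mul]
  · refine lintegral_mono_ae ?_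
    filter_upwards [hH.monotone] with ω hω
    rw [← ENNReal.ofReal_mul (Real.exp_nonneg _), ← Real.exp_add]
    refine ENNReal.ofReal_le_ofReal (Real.exp_le_exp.2 ?_)
    have : ∑ j, w j * H x ω j ≤ ∑ j, w j * H y ω j :=
      Finset.sum_le_sum fun j _ => mul_le_mul_of_nonneg_left (hω hxy j) (hw j)
    linarith
  · have := hH.levy.measurable x
    fun_prop

/-- Multiplicativity passes the bound from `1` to positive fractions. Between fractions, monotone
paths let the transform grow at most by the exponential of the tilt, a factor that tends to `1` as
the fraction approaches `x` from below. -/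
lemma tiltedLaplace_le_one (hH : IsSubordinator P H) [IsProbabilityMeasure P]
    {w : Fin N → ℝ} (hw : ∀ j, 0 ≤ w j) (b : ℝ) (h1 : tiltedLaplace P H w b 1 ≤ 1) (x : ℝ≥0) :
    tiltedLaplace P H w b x ≤ 1 := by
  have hrat : ∀ m n : ℕ, 0 < n → tiltedLaplace P H w b (m * (n : ℝ≥0)⁻¹) ≤ 1 := by
    intro m n hn
    rw [hH.tiltedLaplace_natCast_mul]
    refine pow_le_one₀ zero_le ?_
    have h2 := hH.tiltedLaplace_natCast_mul w b n (n : ℝ≥0)⁻¹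
    rw [mul_inv_cancel₀ (by exact_mod_cast hn.ne')] at h2
    rw [h2] at h1
    by_contra! hlt
    exact absurd h1 (not_le.2 (one_lt_pow₀ hlt hn.ne'))
  have hbound : ∀ n : ℕ, tiltedLaplace P H w b x
      ≤ ENNReal.ofReal (Real.exp (|b| * ((n : ℝ) + 1)⁻¹)) := by
    intro n
    set m : ℕ := ⌊((n + 1 : ℕ) : ℝ≥0) * x⌋₊ with hm
    have hn : (0 : ℝ≥0) < ((n + 1 : ℕ) : ℝ≥0) := by positivity
    have hle1 : (m * ((n + 1 : ℕ) : ℝ≥0)⁻¹ : ℝ≥0) ≤ x := by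
      rw [← div_eq_mul_inv, div_le_iff₀ hn, mul_comm]
      exact Nat.floor_le zero_le
    have hle2 : (x : ℝ) - (m * ((n + 1 : ℕ) : ℝ≥0)⁻¹ : ℝ≥0) ≤ ((n : ℝ) + 1)⁻¹ := by
      have h3 : x ≤ (m + 1) * ((n + 1 : ℕ) : ℝ≥0)⁻¹ := by
        rw [← div_eq_mul_inv, le_div_iff₀ hn, mul_comm]
        exact (Nat.lt_floor_add_one _).le
      have h4 : (x : ℝ) ≤ (m + 1) * ((n : ℝ) + 1)⁻¹ := by
        have := NNReal.coe_le_coe.2 h3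
        push_cast at this
        exact this
      push_cast
      linarith
    refine (hH.tiltedLaplace_le_mul hw b hle1).trans ?_
    refine (mul_le_of_le_one_right zero_le (hrat m (n + 1) n.succ_pos)).trans ?_
    refine ENNReal.ofReal_le_ofReal (Real.exp_le_exp.2 ?_)
    have h0 : (0 : ℝ) ≤ (x : ℝ) - (m * ((n + 1 : ℕ) : ℝ≥0)⁻¹ : ℝ≥0) :=
      sub_nonneg.2 (NNReal.coe_le_coe.2 hle1)
    exact (mul_le_mul_of_nonneg_right (le_abs_self b) h0).trans
      (mul_le_mul_of_nonneg_left hle2 (abs_nonneg b))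
  have h5 : Tendsto (fun n : ℕ => ((n : ℝ) + 1)⁻¹) atTop (𝓝 0) := by
    simpa using tendsto_one_div_add_atTop_nhds_zero_nat (𝕜 := ℝ)
  have h6 := ENNReal.tendsto_ofReal
    ((Real.continuous_exp.tendsto _).comp (h5.const_mul |b|))
  simp only [mul_zero, Real.exp_zero, ENNReal.ofReal_one] at h6
  exact ge_of_tendsto' h6 hbound

end IsSubordinator

/-- If `Y` is bounded below and has positive mean, then `E exp (-ε Y) ≤ 1` for small `ε`. -/
lemma eventually_integral_exp_le_one {Ω : Type*} [MeasurableSpace Ω] {P : Measure Ω}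
    [IsProbabilityMeasure P] {Y : Ω → ℝ} (hY : Integrable Y P) {b : ℝ} (hb : 0 ≤ b)
    (hlow : ∀ᵐ ω ∂P, -b ≤ Y ω) (hpos : 0 < ∫ ω, Y ω ∂P) :
    ∀ᶠ ε in 𝓝[>] (0 : ℝ), ∫⁻ ω, ENNReal.ofReal (Real.exp (-(ε * Y ω))) ∂P ≤ 1 := by
  have hlim : Tendsto (fun ε : ℝ => ∫ ω, ε⁻¹ * (1 - Real.exp (-(ε * Y ω))) ∂P) (𝓝[>] 0)
      (𝓝 (∫ ω, Y ω ∂P)) := by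
    -- The difference quotients of `1 - exp (-ε Y)` at `0` converge to `Y`. For `ε < 1` and `Y ≥ -b`
    -- they are dominated: by `|Y|` where `Y ≥ 0`, and by `exp u - 1 ≤ u exp u` with `u = -ε Y ≤ b`
    -- where `Y ≤ 0`.
    refine tendsto_integral_filter_of_dominated_convergence (fun ω => Real.exp b * |Y ω|) ?_ ?_
      (hY.abs.const_mul _) ?_
    · have := hY.aestronglyMeasurable.aemeasurable
      exact Eventually.of_forall fun ε => by
        apply AEMeasurable.aestronglyMeasurable
        fun_prop
    · filter_upwards [Ioo_mem_nhdsGT one_pos] with ε hε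
      filter_upwards [hlow] with ω hω
      obtain ⟨hε0, hε1⟩ := hε
      rw [Real.norm_eq_abs, abs_mul, abs_of_pos (inv_pos.2 hε0), inv_mul_le_iff₀ hε0]
      have hb1 : 1 ≤ Real.exp b := Real.one_le_exp hb
      have e1 := Real.add_one_le_exp (-(ε * Y ω))
      have e2 := Real.add_one_le_exp (ε * Y ω)
      rcases le_total 0 (Y ω) with h0 | h0
      · have h1 : Real.exp (-(ε * Y ω)) ≤ 1 := Real.exp_le_one_iff.2 (by nlinarith)
        rw [abs_of_nonneg (by linarith), abs_of_nonneg h0]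
        nlinarith [mul_nonneg hε0.le h0]
      · have h1 : 1 ≤ Real.exp (-(ε * Y ω)) := Real.one_le_exp (by nlinarith)
        have h2 : Real.exp (-(ε * Y ω)) ≤ Real.exp b := Real.exp_le_exp.2 (by nlinarith)
        rw [abs_of_nonpos (by linarith), abs_of_nonpos h0]
        have h3 : Real.exp (-(ε * Y ω)) * Real.exp (ε * Y ω) = 1 := by
          rw [← Real.exp_add]
          simp
        have h4 : 0 ≤ -(ε * Y ω) := by nlinarith
        have h5 : Real.exp (-(ε * Y ω)) - 1 ≤ Real.exp (-(ε * Y ω)) * -(ε * Y ω) := by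
          nlinarith [Real.exp_pos (-(ε * Y ω))]
        have h6 := mul_le_mul_of_nonneg_right h2 h4
        nlinarith
    · refine Eventually.of_forall fun ω => ?_
      have hd : HasDerivAt (fun ε : ℝ => 1 - Real.exp (-(ε * Y ω))) (Y ω) 0 := by
        have h1 : HasDerivAt (fun ε : ℝ => -(ε * Y ω)) (-(1 * Y ω)) 0 :=
          ((hasDerivAt_id 0).mul_const (Y ω)).neg
        have h2 := (h1.exp).const_sub 1
        simpa using h2
      have h3 := hd.hasDerivWithinAt (s := Set.Ioi 0)
      rw [hasDerivWithinAt_iff_tendsto_slope' (by simp)] at h3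
      refine h3.congr fun ε => ?_
      simp [slope_def_field, div_eq_inv_mul]
  have hev := hlim.eventually (lt_mem_nhds hpos)
  filter_upwards [hev, Ioo_mem_nhdsGT one_pos] with ε hε hε01
  obtain ⟨hε0, -⟩ := hε01
  have hmeas := hY.aestronglyMeasurable.aemeasurable
  have hint : Integrable (fun ω => Real.exp (-(ε * Y ω))) P := by
    refine Integrable.of_bound (C := Real.exp (ε * b))
      (AEMeasurable.aestronglyMeasurable (by fun_prop)) ?_
    filter_upwards [hlow] with ω hω
    rw [Real.norm_of_nonneg (Real.exp_nonneg _)]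
    exact Real.exp_le_exp.2 (by nlinarith)
  rw [← ofReal_integral_eq_lintegral_ofReal hint
    (Eventually.of_forall fun _ => Real.exp_nonneg _)]
  rw [integral_const_mul, integral_sub (integrable_const _) hint] at hε
  have h7 := pos_of_mul_pos_right hε (inv_nonneg.2 hε0.le)
  simp at h7
  rw [← ENNReal.ofReal_one]
  exact ENNReal.ofReal_le_ofReal h7.le

namespace Visit

variable {N : ℕ} {i : Fin N} {Ω : Type*} [mΩ : MeasurableSpace Ω] {P : Measure Ω}
  [IsProbabilityMeasure P]

lemma replacement_nonneg (V : Visit N i P) (x : ℝ≥0) :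
    ∀ᵐ ω ∂P, 0 ≤ replacement i V.A V.τ x ω := by
  obtain ⟨H, hH, hHeq⟩ := V.branching
  filter_upwards [hHeq x, hH.nonneg] with ω h1 h2
  rw [h1]
  exact h2 x

/-- Monotone paths fix the sign of the difference, and stationary increments give it the law of the
replacement of `|x - y|`. An expected distance thus becomes a mean that is already known. -/
lemma lintegral_abs_replacement_sub (V : Visit N i P) (x y : ℝ≥0) (j : Fin N) :
    ∫⁻ ω, ENNReal.ofReal |replacement i V.A V.τ x ω j - replacement i V.A V.τ y ω j| ∂P
      = ENNReal.ofReal (∫ ω, replacement i V.A V.τ (nndist x y) ω j ∂P) := by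
  wlog hxy : y ≤ x generalizing x y
  · rw [nndist_comm, ← this y x (le_of_not_ge hxy)]
    simp_rw [abs_sub_comm]
  obtain ⟨d, rfl⟩ := exists_add_of_le hxy
  have hd : nndist (y + d) y = d := by
    ext
    simp [NNReal.dist_eq]
  obtain ⟨H, hH, hHeq⟩ := V.branching
  have h1 : ∫⁻ ω, ENNReal.ofReal |replacement i V.A V.τ (y + d) ω j
      - replacement i V.A V.τ y ω j| ∂P = ∫⁻ ω, ENNReal.ofReal ((H (y + d) ω - H y ω) j) ∂P := by
    refine lintegral_congr_ae ?_
    filter_upwards [hHeq (y + d), hHeq y, hH.monotone] with ω h1 h2 h3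
    rw [h1, h2, Pi.sub_apply, abs_of_nonneg (sub_nonneg.2 (h3 hxy j))]
  have h2 : ∫⁻ ω, ENNReal.ofReal ((H (y + d) ω - H y ω) j) ∂P
      = ∫⁻ ω, ENNReal.ofReal (H d ω j) ∂P :=
    ((hH.levy.stationary y d).comp
      (ENNReal.measurable_ofReal.comp (measurable_pi_apply j))).lintegral_eq
  have h3 : ∫⁻ ω, ENNReal.ofReal (H d ω j) ∂P
      = ∫⁻ ω, ENNReal.ofReal (replacement i V.A V.τ d ω j) ∂P := by
    refine lintegral_congr_ae ?_
    filter_upwards [hHeq d] with ω h1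
    rw [h1]
  rw [hd, h1, h2, h3, ofReal_integral_eq_lintegral_ofReal (V.integrable_replacement d j).1]
  filter_upwards [V.replacement_nonneg d] with ω hω
  exact hω j

/-- If the weights `v` have positive drift during the visit, then `exp (-ε v · z)` is a
supermartingale for small `ε`. -/
lemma eventually_lintegral_exp_le (V : Visit N i P) {v : Fin N → ℝ} (hv : ∀ j, 0 < v j)
    (hdrift : 0 < ∑ j, V.rate j * v j) :
    ∀ᶠ ε in 𝓝[>] (0 : ℝ), ∀ x : ℝ≥0, ∫⁻ ω, ENNReal.ofReal (Real.exp
      (-(ε * (∑ j, v j * replacement i V.A V.τ x ω j - v i * x)))) ∂P ≤ 1 := by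
  obtain ⟨c, hc, hmean⟩ := V.exists_mean
  obtain ⟨H, hH, hHeq⟩ := V.branching
  -- The weighted gain of a visit that finds one unit of work. An `ε` is chosen for this case only;
  -- `tiltedLaplace_le_one` makes it serve every `x`.
  set Y : Ω → ℝ := fun ω => ∑ j, v j * replacement i V.A V.τ 1 ω j - v i with hY
  have hint : ∀ j ∈ Finset.univ, Integrable (fun ω => v j * replacement i V.A V.τ 1 ω j) P :=
    fun j _ => (V.integrable_replacement 1 j).1.const_mul _
  have hYint : Integrable Y P := (integrable_finsetSum _ hint).sub (integrable_const _)
  have hYmean : ∫ ω, Y ω ∂P = c * ∑ j, V.rate j * v j := by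
    rw [hY, integral_sub (integrable_finsetSum _ hint) (integrable_const _),
      integral_finsetSum _ hint]
    simp_rw [integral_const_mul, hmean]
    simp only [NNReal.coe_one, mul_one, mul_add, Finset.sum_add_distrib, integral_const,
      probReal_univ, one_smul]
    have : ∑ j, v j * (Pi.single i (1 : ℝ) : Fin N → ℝ) j = v i := by
      simp [Pi.single_apply]
    rw [this, Finset.mul_sum, add_sub_cancel_left]
    exact Finset.sum_congr rfl fun j _ => by ring
  have hlow : ∀ᵐ ω ∂P, -v i ≤ Y ω := by
    filter_upwards [V.replacement_nonneg 1] with ω hω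
    have : 0 ≤ ∑ j, v j * replacement i V.A V.τ 1 ω j :=
      Finset.sum_nonneg fun j _ => mul_nonneg (hv j).le (hω j)
    rw [hY]
    simp only
    linarith
  have hev := eventually_integral_exp_le_one hYint (hv i).le hlow
    (by rw [hYmean]; positivity)
  filter_upwards [hev, self_mem_nhdsWithin] with ε hε hε0 x
  have hε0 : 0 < ε := hε0
  have hrepl : ∀ x : ℝ≥0, ∫⁻ ω, ENNReal.ofReal (Real.exp
      (-(ε * (∑ j, v j * replacement i V.A V.τ x ω j - v i * x)))) ∂P
      = IsSubordinator.tiltedLaplace P H (fun j => ε * v j) (ε * v i) x := by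
    intro x
    refine lintegral_congr_ae ?_
    filter_upwards [hHeq x] with ω hω
    rw [hω]
    congr 2
    simp only [mul_assoc, ← Finset.mul_sum]
    ring
  rw [hrepl]
  refine hH.tiltedLaplace_le_one (fun j => (mul_pos hε0 (hv j)).le) _ ?_ x
  rw [← hrepl]
  simpa [hY] using hε

end Visit

end Polling

/-! ### Joint measurability and drift criteria for one cycle -/

namespace Polling

/-- A Lévy process has a jointly measurable version that differs from it only on a null set of
paths. -/
lemma IsLevy.exists_measurable_version {N : ℕ} {Ω : Type*} [MeasurableSpace Ω] {P : Measure Ω}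
    {X : ℝ≥0 → Ω → (Fin N → ℝ)} (hX : IsLevy P X) :
    ∃ X' : ℝ≥0 → Ω → (Fin N → ℝ), Measurable (fun p : ℝ≥0 × Ω => X' p.1 p.2) ∧
      ∀ᵐ ω ∂P, ∀ t, X' t ω = X t ω := by
  set B : Set Ω := {ω | ¬ ∀ t, ContinuousWithinAt (fun s => X s ω) (Set.Ioi t) t} with hB
  have hBnull : P B = 0 := by
    have : ∀ᵐ ω ∂P, ∀ t, ContinuousWithinAt (fun s => X s ω) (Set.Ioi t) t :=
      hX.cadlag.mono fun ω h t => (h t).1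
    exact ae_iff.1 this
  -- The set of bad paths need not be measurable, so a measurable null set containing it is
  -- discarded.
  set G : Set Ω := (toMeasurable P B)ᶜ with hG
  have hGm : MeasurableSet G := (measurableSet_toMeasurable P B).compl
  have hGc : ∀ ω ∈ G, ∀ t, ContinuousWithinAt (fun s => X s ω) (Set.Ioi t) t := by
    intro ω hω
    by_contra hcon
    exact hω (subset_toMeasurable P B hcon)
  refine ⟨fun t => G.indicator (X t), ?_, ?_⟩
  -- The first multiple of `1 / (n + 1)` strictly after `t`: the approximations are piecewise
  -- constant in time and converge from the right.
  · set r : ℕ → ℝ≥0 → ℝ≥0 := fun n t => ((⌊t * (n + 1)⌋₊ + 1 : ℕ) : ℝ≥0) / (n + 1) with hr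
    have hn : ∀ n : ℕ, (0 : ℝ≥0) < n + 1 := fun n => by positivity
    refine measurable_of_tendsto_metrizable
      (f := fun (n : ℕ) (p : ℝ≥0 × Ω) => G.indicator (X (r n p.1)) p.2) (fun n => ?_) ?_
    · have hκ : Measurable fun p : ℝ≥0 × Ω => ⌊p.1 * (n + 1)⌋₊ + 1 :=
        (Nat.measurable_floor.comp (measurable_fst.mul_const _)).add_const 1
      exact measurable_of_countable_choice
        (f := fun (k : ℕ) (p : ℝ≥0 × Ω) => G.indicator (X ((k : ℝ≥0) / (n + 1))) p.2)
        (fun k => ((hX.measurable _).indicator hGm).comp measurable_snd) hκ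
    · rw [tendsto_pi_nhds]
      rintro ⟨t, ω⟩
      by_cases hω : ω ∈ G
      · simp only [Set.indicator_of_mem hω]
        have hgt : ∀ n, t < r n t := fun n => by
          rw [hr]
          simp only
          rw [lt_div_iff₀ (hn n)]
          push_cast
          exact Nat.lt_floor_add_one _
        have hle : ∀ n, r n t ≤ t + 1 / ((n : ℝ≥0) + 1) := fun n => by
          rw [hr]
          simp only
          rw [div_le_iff₀ (hn n), add_mul, one_div, inv_mul_cancel₀ (hn n).ne']
          push_cast
          gcongr
          exact Nat.floor_le zero_le
        have ht : Tendsto (fun n => r n t) atTop (𝓝 t) := by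
          refine tendsto_of_tendsto_of_tendsto_of_le_of_le tendsto_const_nhds ?_
            (fun n => (hgt n).le) hle
          have := tendsto_one_div_add_atTop_nhds_zero_nat (𝕜 := ℝ≥0)
          simpa using tendsto_const_nhds.add this
        exact (hGc ω hω t).tendsto.comp
          (tendsto_nhdsWithin_iff.2 ⟨ht, Eventually.of_forall hgt⟩)
      · simp only [Set.indicator_of_notMem hω]
        exact tendsto_const_nhds
  · have : ∀ᵐ ω ∂P, ω ∈ G := by
      rw [ae_iff]
      simpa [hG, measure_toMeasurable] using hBnull
    filter_upwards [this] with ω hω t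
    exact Set.indicator_of_mem hω _

section Drift

variable {ι : Type*} [Fintype ι] [DecidableEq ι] {X : ι → Type*} [∀ i, MeasurableSpace (X i)]
  (μ : ∀ i, Measure (X i)) [∀ i, IsProbabilityMeasure (μ i)]

/-- Resampling one coordinate does not change a product law. It isolates the randomness of the last
step of a fold from the earlier steps. -/
lemma lintegral_pi_eq_lintegral_update {f : (∀ i, X i) → ℝ≥0∞} (hf : Measurable f) (i : ι) :
    ∫⁻ ω, f ω ∂Measure.pi μ
      = ∫⁻ ω, ∫⁻ x, f (Function.update ω i x) ∂μ i ∂Measure.pi μ := by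
  have hg : Measurable fun ω : ∀ i, X i => ∫⁻ x, f (Function.update ω i x) ∂μ i :=
    Measurable.lintegral_prod_right' (f := fun p : (∀ i, X i) × X i => f (Function.update p.1 i p.2))
      (hf.comp measurable_update')
  have : Nonempty (∀ i, X i) := ⟨fun i => (nonempty_of_isProbabilityMeasure (μ i)).some⟩
  obtain ⟨ω₀⟩ := this
  rw [lintegral_eq_lmarginal_univ ω₀, lintegral_eq_lmarginal_univ ω₀,
    lmarginal_erase' f hf (Finset.mem_univ i), lmarginal_erase' _ hg (Finset.mem_univ i)]
  simp

variable {E : Type*} [MeasurableSpace E] {S : ∀ i, X i × E → E}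

lemma measurable_foldl (hS : ∀ i, Measurable (S i)) (l : List ι) :
    Measurable fun p : (∀ i, X i) × E => l.foldl (fun y i => S i (p.1 i, y)) p.2 := by
  induction l using List.reverseRecOn with
  | nil => exact measurable_snd
  | append_singleton l i ih =>
    simp only [List.foldl_append, List.foldl_cons, List.foldl_nil]
    exact (hS i).comp ((measurable_pi_apply i |>.comp measurable_fst).prodMk ih)

lemma foldl_update (l : List ι) {i : ι} (hi : i ∉ l) (ω : ∀ i, X i) (x : X i) (z : E) :
    l.foldl (fun y j => S j (Function.update ω i x j, y)) z = l.foldl (fun y j => S j (ω j, y)) z := by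
  refine List.foldl_ext _ _ _ fun y j hj => ?_
  have hne : j ≠ i := by
    rintro rfl
    exact hi hj
  rw [Function.update_of_ne hne]

/-- A family of functions that decreases in the mean at every step of an iteration with
independent steps decreases in the mean along the whole iteration. -/
lemma lintegral_foldl_le (hS : ∀ i, Measurable (S i)) {V : Finset ι → E → ℝ≥0∞} (hV : ∀ s, Measurable (V s))
    (h : ∀ i s, i ∉ s → ∀ z, ∫⁻ x, V (insert i s) (S i (x, z)) ∂μ i ≤ V s z)
    (l : List ι) (hl : l.Nodup) (z : E) :
    ∫⁻ ω, V l.toFinset (l.foldl (fun y i => S i (ω i, y)) z) ∂Measure.pi μ ≤ V ∅ z := by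
  induction l using List.reverseRecOn with
  | nil => simp
  | append_singleton l i ih =>
    have hnd := List.nodup_append.1 hl
    have hi : i ∉ l := fun hmem => hnd.2.2 i hmem i (by simp) rfl
    have hset : (l ++ [i]).toFinset = insert i l.toFinset := by
      ext
      simp
    have hm : Measurable fun ω : ∀ i, X i => l.foldl (fun y i => S i (ω i, y)) z :=
      (measurable_foldl hS l).comp (measurable_id.prodMk measurable_const)
    refine le_trans ?_ (ih hnd.1)
    rw [hset]
    simp only [List.foldl_append, List.foldl_cons, List.foldl_nil]
    rw [lintegral_pi_eq_lintegral_update μ (i := i)]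
    · refine lintegral_mono fun ω => ?_
      simp only [foldl_update l hi, Function.update_self]
      exact h i l.toFinset (by simpa using hi) _
    · exact (hV _).comp ((hS i).comp ((measurable_pi_apply i).prodMk hm))

end Drift

namespace PollingSystem

variable {N : ℕ} {Ω Ω' : Fin N → Type*} [∀ i, MeasurableSpace (Ω i)]
  [∀ i, MeasurableSpace (Ω' i)] {P : ∀ i, Measure (Ω i)} {P' : ∀ i, Measure (Ω' i)}
  [∀ i, IsProbabilityMeasure (P i)] [∀ i, IsProbabilityMeasure (P' i)]

/-- The model evaluates processes at random times and at random workloads, so joint measurability is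
needed. The exceptional null set does not depend on `z`, which permits substituting a random
workload. -/
lemma exists_step (Q : PollingSystem P P') (i : Fin N) :
    ∃ S : (Ω i × Ω' i) × (Fin N → ℝ) → (Fin N → ℝ), Measurable S ∧
      ∀ᵐ x ∂((P i).prod (P' i)), ∀ z, S (x, z) = Q.afterVisit i x.1 z + Q.switchInput i x.2 := by
  obtain ⟨A', hA'm, hA'⟩ := (Q.visit i).levy.levy.exists_measurable_version
  obtain ⟨W', hW'm, hW'⟩ := (Q.switch i).subordinator.levy.exists_measurable_version
  have hzi : Measurable fun p : (Ω i × Ω' i) × (Fin N → ℝ) => p.2 i :=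
    (measurable_pi_apply i).comp measurable_snd
  have hsingle : ∀ {g : (Ω i × Ω' i) × (Fin N → ℝ) → ℝ}, Measurable g →
      Measurable fun p => (Pi.single i (g p) : Fin N → ℝ) := by
    intro g hg
    refine measurable_pi_lambda _ fun j => ?_
    by_cases hj : j = i
    · subst hj
      simpa using hg
    · simp [Pi.single_eq_of_ne hj]
  have hτ : Measurable fun p : (Ω i × Ω' i) × (Fin N → ℝ) =>
      ((Q.visit i).τ (p.2 i).toNNReal p.1.1).toNNReal :=
    ((Q.visit i).measurable_τ.comp (hzi.real_toNNReal.prodMk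
      (measurable_fst.comp measurable_fst))).ennreal_toNNReal
  refine ⟨fun p => p.2 - Pi.single i (p.2 i)
    + (Pi.single i ((p.2 i).toNNReal : ℝ) + A' ((Q.visit i).τ (p.2 i).toNNReal p.1.1).toNNReal p.1.1)
    + W' ((Q.switch i).S p.1.2) p.1.2, ?_, ?_⟩
  · refine Measurable.add (Measurable.add (Measurable.sub measurable_snd (hsingle hzi))
      (Measurable.add (hsingle hzi.real_toNNReal.coe_nnreal_real) ?_)) ?_
    · exact hA'm.comp (hτ.prodMk (measurable_fst.comp measurable_fst))
    · exact hW'm.comp (((Q.switch i).measurable_S.comp (measurable_snd.comp measurable_fst)).prodMk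
        (measurable_snd.comp measurable_fst))
  · have h1 : ∀ᵐ x ∂((P i).prod (P' i)), ∀ t, A' t x.1 = (Q.visit i).A t x.1 :=
      Measure.quasiMeasurePreserving_fst.ae hA'
    have h2 : ∀ᵐ x ∂((P i).prod (P' i)), ∀ t, W' t x.2 = (Q.switch i).W t x.2 :=
      Measure.quasiMeasurePreserving_snd.ae hW'
    filter_upwards [h1, h2] with x hx1 hx2 z
    simp only [hx1, hx2]
    rfl

/-- A jointly measurable version of the effect of a visit and the switch-over period after it. -/
noncomputable def step (Q : PollingSystem P P') (i : Fin N) :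
    (Ω i × Ω' i) × (Fin N → ℝ) → (Fin N → ℝ) := (Q.exists_step i).choose

lemma measurable_step (Q : PollingSystem P P') (i : Fin N) : Measurable (Q.step i) :=
  (Q.exists_step i).choose_spec.1

lemma step_ae_eq (Q : PollingSystem P P') (i : Fin N) :
    ∀ᵐ x ∂((P i).prod (P' i)), ∀ z,
      Q.step i (x, z) = Q.afterVisit i x.1 z + Q.switchInput i x.2 :=
  (Q.exists_step i).choose_spec.2

/-- A jointly measurable version of the effect of a cycle. -/
noncomputable def cycleMap (Q : PollingSystem P P') (p : (∀ i, Ω i × Ω' i) × (Fin N → ℝ)) :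
    Fin N → ℝ := (List.finRange N).foldl (fun y i => Q.step i (p.1 i, y)) p.2

lemma measurable_cycleMap (Q : PollingSystem P P') : Measurable Q.cycleMap :=
  measurable_foldl Q.measurable_step _

lemma cycleMap_ae_eq (Q : PollingSystem P P') :
    ∀ᵐ ω ∂(cycleMeasure P P'), ∀ z, Q.cycleMap (ω, z) = Q.cycle ω z := by
  have h : ∀ᵐ ω ∂(cycleMeasure P P'), ∀ i, ∀ z,
      Q.step i (ω i, z) = Q.afterVisit i (ω i).1 z + Q.switchInput i (ω i).2 := by
    rw [ae_all_iff]
    intro i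
    exact (measurePreserving_eval (fun i => (P i).prod (P' i)) i).quasiMeasurePreserving.ae
      (Q.step_ae_eq i)
  filter_upwards [h] with ω hω z
  exact List.foldl_ext _ _ _ fun y i _ => hω i y

/-- The drift criterion for a cycle. -/
lemma lintegral_cycleMap_le (Q : PollingSystem P P') {V : Finset (Fin N) → (Fin N → ℝ) → ℝ≥0∞}
    (hV : ∀ s, Measurable (V s))
    (h : ∀ i s, i ∉ s → ∀ z, ∫⁻ x, V (insert i s) (Q.step i (x, z)) ∂((P i).prod (P' i)) ≤ V s z)
    (z : Fin N → ℝ) :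
    ∫⁻ ω, V Finset.univ (Q.cycleMap (ω, z)) ∂(cycleMeasure P P') ≤ V ∅ z := by
  have := lintegral_foldl_le (fun i => (P i).prod (P' i)) Q.measurable_step hV h
    (List.finRange N) (List.nodup_finRange N) z
  rwa [List.toFinset_finRange] at this

/-- The drift criterion for two copies of a cycle that are driven by the same randomness. -/
lemma lintegral_cycleMap_pair_le (Q : PollingSystem P P')
    {V : Finset (Fin N) → (Fin N → ℝ) × (Fin N → ℝ) → ℝ≥0∞} (hV : ∀ s, Measurable (V s))
    (h : ∀ i s, i ∉ s → ∀ z z', ∫⁻ x, V (insert i s) (Q.step i (x, z), Q.step i (x, z'))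
      ∂((P i).prod (P' i)) ≤ V s (z, z')) (z z' : Fin N → ℝ) :
    ∫⁻ ω, V Finset.univ (Q.cycleMap (ω, z), Q.cycleMap (ω, z')) ∂(cycleMeasure P P')
      ≤ V ∅ (z, z') := by
  have hS : ∀ i, Measurable fun p : (Ω i × Ω' i) × ((Fin N → ℝ) × (Fin N → ℝ)) =>
      (Q.step i (p.1, p.2.1), Q.step i (p.1, p.2.2)) := fun i =>
    ((Q.measurable_step i).comp (measurable_fst.prodMk (measurable_fst.comp measurable_snd))).prodMk
      ((Q.measurable_step i).comp (measurable_fst.prodMk (measurable_snd.comp measurable_snd)))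
  have := lintegral_foldl_le (fun i => (P i).prod (P' i)) hS hV
    (fun i s hi p => h i s hi p.1 p.2) (List.finRange N) (List.nodup_finRange N) (z, z')
  rw [List.toFinset_finRange] at this
  refine le_trans (le_of_eq (lintegral_congr fun ω => ?_)) this
  congr 1
  have hpair : ∀ (l : List (Fin N)) (y y' : Fin N → ℝ),
      l.foldl (fun (p : (Fin N → ℝ) × (Fin N → ℝ)) i =>
        (Q.step i (ω i, p.1), Q.step i (ω i, p.2))) (y, y')
      = (l.foldl (fun y i => Q.step i (ω i, y)) y, l.foldl (fun y i => Q.step i (ω i, y)) y') := by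
    intro l
    induction l with
    | nil => simp
    | cons i l ih => intro y y'; simp [ih]
  exact (hpair _ z z').symm

end PollingSystem

end Polling

/-! ### Iterated random maps -/

namespace Polling

section RandomIteration

variable {C E : Type*} [MeasurableSpace C] [MeasurableSpace E] {m : Measure C}
  [IsProbabilityMeasure m]

/-- A sequence, from its head and its tail. -/
def seqCons (c : C) (ω : ℕ → C) : ℕ → C
  | 0 => c
  | n + 1 => ω n

lemma measurable_seqCons : Measurable fun p : C × (ℕ → C) => seqCons p.1 p.2 := by
  refine measurable_pi_lambda _ fun n => ?_
  cases n with
  | zero => exact measurable_fst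
  | succ n => exact (measurable_pi_apply n).comp measurable_snd

/-- The head of an i.i.d. sequence is independent of its tail, which has the law of the whole
sequence. -/
lemma map_seqCons : (m.prod (Measure.infinitePi fun _ : ℕ => m)).map (fun p => seqCons p.1 p.2)
    = Measure.infinitePi fun _ : ℕ => m := by
  classical
  refine Measure.eq_infinitePi _ fun s t ht => ?_
  -- The box is padded to an initial segment of indices, so that the head splits off and the tail is
  -- an initial segment again.
  set t' : ℕ → Set C := fun i => if i ∈ s then t i else Set.univ with ht'
  have ht'm : ∀ i, MeasurableSet (t' i) := fun i => by
    rw [ht']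
    simp only
    split_ifs
    exacts [ht i, MeasurableSet.univ]
  obtain ⟨K, hK⟩ : ∃ K, s ⊆ Finset.range (K + 1) :=
    ⟨s.sup id, fun i hi => Finset.mem_range.2 (Nat.lt_succ_of_le (Finset.le_sup (f := id) hi))⟩
  have hbox : (s : Set ℕ).pi t = (Finset.range (K + 1) : Set ℕ).pi t' := by
    ext ω
    simp only [Set.mem_pi, Finset.mem_coe, ht']
    constructor
    · intro h i _
      split_ifs with hi
      exacts [h i hi, Set.mem_univ _]
    · intro h i hi
      simpa [hi] using h i (hK hi)
  have hprod : ∏ i ∈ s, m (t i) = ∏ i ∈ Finset.range (K + 1), m (t' i) := by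
    rw [← Finset.prod_subset hK]
    · exact Finset.prod_congr rfl fun i hi => by simp [ht', hi]
    · intro i _ hi
      simp [ht', hi]
  have hpre : (fun p : C × (ℕ → C) => seqCons p.1 p.2) ⁻¹' (Finset.range (K + 1) : Set ℕ).pi t'
      = t' 0 ×ˢ (Finset.range K : Set ℕ).pi (fun i => t' (i + 1)) := by
    ext ⟨c, ω⟩
    simp only [Set.mem_preimage, Set.mem_pi, Finset.mem_coe, Finset.mem_range, Set.mem_prod]
    constructor
    · intro h
      exact ⟨h 0 (Nat.succ_pos _), fun i hi => h (i + 1) (by omega)⟩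
    · rintro ⟨h0, h1⟩ i hi
      cases i with
      | zero => exact h0
      | succ i => exact h1 i (by omega)
  rw [hprod, hbox, Measure.map_apply measurable_seqCons
    (MeasurableSet.pi (Finset.countable_toSet _) fun i _ => ht'm i), hpre, Measure.prod_prod,
    Measure.infinitePi_pi _ (fun i _ => ht'm (i + 1)), Finset.prod_range_succ', mul_comm]

lemma lintegral_seqCons {f : (ℕ → C) → ℝ≥0∞} (hf : Measurable f) :
    ∫⁻ ω, f ω ∂(Measure.infinitePi fun _ : ℕ => m)
      = ∫⁻ c, ∫⁻ ω, f (seqCons c ω) ∂(Measure.infinitePi fun _ : ℕ => m) ∂m := by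
  conv_lhs => rw [← map_seqCons (m := m)]
  rw [lintegral_map hf measurable_seqCons]
  exact lintegral_prod _ (hf.comp measurable_seqCons).aemeasurable

/-- The iteration of a random map with independent copies of the randomness. -/
def walk (F : C × E → E) : ℕ → E × (ℕ → C) → E
  | 0, p => p.1
  | n + 1, p => F (p.2 n, walk F n p)

/-- The backward iteration: the newest copy of the randomness is applied first. -/
def backwardWalk (F : C × E → E) (z₀ : E) : ℕ → (ℕ → C) → E
  | 0, _ => z₀
  | n + 1, ω => F (ω 0, backwardWalk F z₀ n (fun k => ω (k + 1)))

variable {F : C × E → E}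

lemma walk_seqCons (n : ℕ) (z : E) (c : C) (ω : ℕ → C) :
    walk F (n + 1) (z, seqCons c ω) = walk F n (F (c, z), ω) := by
  induction n with
  | zero => rfl
  | succ n ih =>
    rw [walk, ih]
    rfl

lemma backwardWalk_seqCons (z₀ : E) (n : ℕ) (c : C) (ω : ℕ → C) :
    backwardWalk F z₀ (n + 1) (seqCons c ω) = F (c, backwardWalk F z₀ n ω) := rfl

lemma measurable_walk (hF : Measurable F) (n : ℕ) : Measurable (walk F n) := by
  induction n with
  | zero => exact measurable_fst
  | succ n ih => exact hF.comp (((measurable_pi_apply n).comp measurable_snd).prodMk ih)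

lemma measurable_walk_right (hF : Measurable F) (n : ℕ) (z : E) :
    Measurable fun ω => walk F n (z, ω) :=
  (measurable_walk hF n).comp (measurable_const.prodMk measurable_id)

lemma measurable_backwardWalk (hF : Measurable F) (z₀ : E) (n : ℕ) :
    Measurable (backwardWalk F z₀ n) := by
  induction n with
  | zero => exact measurable_const
  | succ n ih =>
    exact hF.comp ((measurable_pi_apply 0).prodMk
      (ih.comp (measurable_pi_lambda _ fun k => measurable_pi_apply (k + 1))))

/-- The transition operator of the iteration. -/
noncomputable def transition (m : Measure C) (F : C × E → E) (f : E → ℝ≥0∞) (z : E) : ℝ≥0∞ :=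
  ∫⁻ c, f (F (c, z)) ∂m

lemma measurable_transition (hF : Measurable F) {f : E → ℝ≥0∞} (hf : Measurable f) :
    Measurable (transition m F f) :=
  Measurable.lintegral_prod_left' (f := fun p : C × E => f (F p)) (hf.comp hF)

lemma lintegral_walk (hF : Measurable F) (n : ℕ) {f : E → ℝ≥0∞} (hf : Measurable f) (z : E) :
    ∫⁻ ω, f (walk F n (z, ω)) ∂(Measure.infinitePi fun _ : ℕ => m) = (transition m F)^[n] f z := by
  induction n generalizing z with
  | zero => simp [walk]
  | succ n ih =>
    rw [lintegral_seqCons (f := fun ω => f (walk F (n + 1) (z, ω)))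
      (hf.comp (measurable_walk_right hF _ _)), Function.iterate_succ_apply']
    simp only [walk_seqCons, ih]
    rfl

/-- Forward and backward iteration share the same power of the transition operator, hence the law at
each fixed `n`; here the head of the sequence is the last map applied, so the operator acts on `f`
first. -/
lemma lintegral_backwardWalk (hF : Measurable F) (z₀ : E) (n : ℕ) {f : E → ℝ≥0∞}
    (hf : Measurable f) :
    ∫⁻ ω, f (backwardWalk F z₀ n ω) ∂(Measure.infinitePi fun _ : ℕ => m)
      = (transition m F)^[n] f z₀ := by
  induction n generalizing f with
  | zero => simp [backwardWalk]
  | succ n ih =>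
    rw [lintegral_seqCons (f := fun ω => f (backwardWalk F z₀ (n + 1) ω))
      (hf.comp (measurable_backwardWalk hF _ _)), Function.iterate_succ_apply,
      ← ih (measurable_transition hF hf)]
    simp only [backwardWalk_seqCons]
    rw [lintegral_lintegral_swap]
    · rfl
    · exact (hf.comp (hF.comp (measurable_fst.prodMk
        ((measurable_backwardWalk hF z₀ n).comp measurable_snd)))).aemeasurable

/-- A function that decreases in the mean by the factor `γ` in every step of the iteration. -/
lemma lintegral_walk_le (hF : Measurable F) {f : E → ℝ≥0∞} (hf : Measurable f) {γ : ℝ≥0∞}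
    (h : ∀ z, ∫⁻ c, f (F (c, z)) ∂m ≤ γ * f z) (n : ℕ) (z : E) :
    ∫⁻ ω, f (walk F n (z, ω)) ∂(Measure.infinitePi fun _ : ℕ => m) ≤ γ ^ n * f z := by
  induction n generalizing z with
  | zero => simp [walk]
  | succ n ih =>
    rw [lintegral_seqCons (f := fun ω => f (walk F (n + 1) (z, ω)))
      (hf.comp (measurable_walk_right hF _ _))]
    simp only [walk_seqCons]
    calc _ ≤ ∫⁻ c, γ ^ n * f (F (c, z)) ∂m := lintegral_mono fun c => ih _
      _ = γ ^ n * ∫⁻ c, f (F (c, z)) ∂m := lintegral_const_mul _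
          (hf.comp (hF.comp (measurable_id.prodMk measurable_const)))
      _ ≤ γ ^ n * (γ * f z) := by gcongr; exact h z
      _ = γ ^ (n + 1) * f z := by rw [pow_succ, mul_assoc]

lemma lintegral_walk_pair_le (hF : Measurable F) {D : E × E → ℝ≥0∞} (hD : Measurable D)
    {θ : ℝ≥0∞} (h : ∀ z z', ∫⁻ c, D (F (c, z), F (c, z')) ∂m ≤ θ * D (z, z')) (n : ℕ) (z z' : E) :
    ∫⁻ ω, D (walk F n (z, ω), walk F n (z', ω)) ∂(Measure.infinitePi fun _ : ℕ => m)
      ≤ θ ^ n * D (z, z') := by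
  have hF2 : Measurable fun p : C × (E × E) => (F (p.1, p.2.1), F (p.1, p.2.2)) := by
    fun_prop
  have hwalk : ∀ n (ω : ℕ → C), walk (fun p : C × (E × E) => (F (p.1, p.2.1), F (p.1, p.2.2))) n
      ((z, z'), ω) = (walk F n (z, ω), walk F n (z', ω)) := by
    intro n ω
    induction n with
    | zero => rfl
    | succ n ih => simp [walk, ih]
  have := lintegral_walk_le (m := m) hF2 hD (fun p => h p.1 p.2) n (z, z')
  simpa only [hwalk] using this

/-- Consecutive backward iterates apply the same `n` outer maps, one to `F (c, z₀)` and the other to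
`z₀`. Each common map contributes a factor `θ`. -/
lemma lintegral_backwardWalk_succ_le (hF : Measurable F) {D : E × E → ℝ≥0∞} (hD : Measurable D)
    {θ : ℝ≥0∞} (h : ∀ z z', ∫⁻ c, D (F (c, z), F (c, z')) ∂m ≤ θ * D (z, z')) (z₀ : E) (n : ℕ) :
    ∫⁻ ω, D (backwardWalk F z₀ (n + 1) ω, backwardWalk F z₀ n ω)
        ∂(Measure.infinitePi fun _ : ℕ => m)
      ≤ θ ^ n * ∫⁻ c, D (F (c, z₀), z₀) ∂m := by
  have hb := fun n => measurable_backwardWalk hF z₀ n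
  have hmeas : ∀ n, Measurable fun ω : ℕ → C =>
      D (backwardWalk F z₀ (n + 1) ω, backwardWalk F z₀ n ω) := fun n =>
    hD.comp ((hb _).prodMk (hb _))
  induction n with
  | zero =>
    rw [lintegral_seqCons (hmeas 0)]
    simp [backwardWalk, seqCons]
  | succ n ih =>
    rw [lintegral_seqCons (hmeas (n + 1))]
    simp only [backwardWalk_seqCons]
    rw [lintegral_lintegral_swap]
    · calc _ ≤ ∫⁻ ω, θ * D (backwardWalk F z₀ (n + 1) ω, backwardWalk F z₀ n ω)
            ∂(Measure.infinitePi fun _ : ℕ => m) := lintegral_mono fun ω => h _ _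
        _ = θ * ∫⁻ ω, D (backwardWalk F z₀ (n + 1) ω, backwardWalk F z₀ n ω)
            ∂(Measure.infinitePi fun _ : ℕ => m) := lintegral_const_mul _ (hmeas n)
        _ ≤ θ * (θ ^ n * ∫⁻ c, D (F (c, z₀), z₀) ∂m) := by gcongr
        _ = _ := by rw [pow_succ', mul_assoc]
    · refine (hD.comp (Measurable.prodMk ?_ ?_)).aemeasurable
      · exact hF.comp (measurable_fst.prodMk ((hb (n + 1)).comp measurable_snd))
      · exact hF.comp (measurable_fst.prodMk ((hb n).comp measurable_snd))

end RandomIteration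

section Contraction

variable {C E : Type*} [MeasurableSpace C] {m : Measure C} [IsProbabilityMeasure m]
  [NormedAddCommGroup E] [CompleteSpace E] [SecondCountableTopology E] [MeasurableSpace E]
  [BorelSpace E]

/-- The iteration of a random map that contracts in the mean converges in distribution, to a limit
that does not depend on the initial law. -/
theorem exists_tendstoInDistribution_walk {F : C × E → E} (hF : Measurable F)
    {D : E × E → ℝ≥0∞} (hD : Measurable D) {K : ℝ≥0∞} (hK : K ≠ ∞)
    (hDdist : ∀ z z', edist z z' ≤ K * D (z, z')) {z₀ : E} (hDfin : ∀ z, D (z, z₀) ≠ ∞)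
    {θ : ℝ≥0∞} (hθ : θ < 1) (h : ∀ z z', ∫⁻ c, D (F (c, z), F (c, z')) ∂m ≤ θ * D (z, z'))
    (h0 : ∫⁻ c, D (F (c, z₀), z₀) ∂m ≠ ∞) :
    ∃ Z : (ℕ → C) → E, Measurable Z ∧
      (∀ᵐ ω ∂(Measure.infinitePi fun _ : ℕ => m),
        Tendsto (fun n => backwardWalk F z₀ n ω) atTop (𝓝 (Z ω))) ∧
      ∀ (μ : Measure E) [IsProbabilityMeasure μ],
        TendstoInDistribution (walk F) atTop Z
          (fun _ => μ.prod (Measure.infinitePi fun _ : ℕ => m))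
          (Measure.infinitePi fun _ : ℕ => m) := by
  set ν := Measure.infinitePi fun _ : ℕ => m with hν
  have hb := fun n => measurable_backwardWalk hF z₀ n
  have hbD : ∀ n, Measurable fun ω : ℕ → C =>
      D (backwardWalk F z₀ (n + 1) ω, backwardWalk F z₀ n ω) :=
    fun n => hD.comp ((hb _).prodMk (hb _))
  have hgeom : ∑' n, θ ^ n ≠ ∞ := by
    rw [ENNReal.tsum_geometric]
    exact ENNReal.inv_ne_top.2 (tsub_pos_of_lt hθ).ne'
  have hcauchy : ∀ᵐ ω ∂ν, ∃ l, Tendsto (fun n => backwardWalk F z₀ n ω) atTop (𝓝 l) := by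
    have hsum : ∫⁻ ω, ∑' n, D (backwardWalk F z₀ (n + 1) ω, backwardWalk F z₀ n ω) ∂ν ≠ ∞ := by
      rw [lintegral_tsum fun n => (hbD n).aemeasurable]
      refine ne_top_of_le_ne_top ?_ (ENNReal.tsum_le_tsum fun n =>
        lintegral_backwardWalk_succ_le hF hD h z₀ n)
      rw [ENNReal.tsum_mul_right]
      exact ENNReal.mul_ne_top hgeom h0
    filter_upwards [ae_lt_top (Measurable.tsum hbD) hsum] with ω hω
    refine cauchySeq_tendsto_of_complete (cauchySeq_of_edist_le_of_tsum_ne_top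
      (fun n => K * D (backwardWalk F z₀ (n + 1) ω, backwardWalk F z₀ n ω)) (fun n => ?_) ?_)
    · rw [edist_comm]
      exact hDdist _ _
    · rw [ENNReal.tsum_mul_left]
      exact ENNReal.mul_ne_top hK hω.ne
  obtain ⟨Z, hZm, hZ⟩ := measurable_limit_of_tendsto_metrizable_ae
    (fun n => (hb n).aemeasurable) hcauchy
  refine ⟨Z, hZm, hZ, fun μ _ => ?_⟩
  have hback := tendstoInDistribution_of_ae_tendsto (fun n => (hb n).aemeasurable)
    hZm.aemeasurable hZ
  have hw0 : ∀ n, Measurable fun p : E × (ℕ → C) => walk F n (z₀, p.2) := fun n =>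
    (measurable_walk_right hF n z₀).comp measurable_snd
  -- Almost sure convergence holds for the backward iterates only; equality of laws transfers it to
  -- the forward iterates as convergence in distribution.
  have hlaw : ∀ n, (μ.prod ν).map (fun p => walk F n (z₀, p.2)) = ν.map (backwardWalk F z₀ n) := by
    intro n
    refine Measure.ext fun s hs => ?_
    rw [← lintegral_indicator_one hs, ← lintegral_indicator_one hs,
      lintegral_map (measurable_one.indicator hs) (hw0 n),
      lintegral_map (measurable_one.indicator hs) (hb n),
      lintegral_backwardWalk hF z₀ n (measurable_one.indicator hs),
      ← lintegral_walk hF n (measurable_one.indicator hs) z₀]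
    have hm : Measurable fun ω : ℕ → C => s.indicator (1 : E → ℝ≥0∞) (walk F n (z₀, ω)) :=
      (measurable_one.indicator hs).comp (measurable_walk_right hF n z₀)
    exact measurePreserving_snd.lintegral_comp hm
  have hfrom0 : TendstoInDistribution (fun n p => walk F n (z₀, p.2)) atTop Z
      (fun _ => μ.prod ν) ν := by
    refine ⟨fun n => (hw0 n).aemeasurable, hZm.aemeasurable, ?_⟩
    refine hback.tendsto.congr fun n => ?_
    exact Subtype.ext (hlaw n).symm
  refine tendstoInDistribution_of_tendstoInMeasure_sub (walk F) Z hfrom0 ?_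
    (fun n => (measurable_walk hF n).aemeasurable)
  refine tendstoInMeasure_of_tendsto_ae (fun n =>
    ((measurable_walk hF n).sub (hw0 n)).aestronglyMeasurable) ?_
  have hDm : ∀ n, Measurable fun p : E × (ℕ → C) => D (walk F n p, walk F n (z₀, p.2)) :=
    fun n => hD.comp ((measurable_walk hF n).prodMk (hw0 n))
  -- The coupling is summed for each fixed starting point and integrated afterwards, so the initial
  -- law needs no moments.
  have hae : ∀ᵐ p ∂(μ.prod ν), ∑' n, D (walk F n p, walk F n (z₀, p.2)) < ∞ := by
    rw [Measure.ae_prod_iff_ae_ae (measurableSet_lt (Measurable.tsum hDm) measurable_const)]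
    refine Eventually.of_forall fun z => ?_
    have hDz : ∀ n, Measurable fun ω : ℕ → C => D (walk F n (z, ω), walk F n (z₀, ω)) :=
      fun n => (hDm n).comp (measurable_const.prodMk measurable_id)
    refine ae_lt_top (Measurable.tsum hDz) ?_
    rw [lintegral_tsum fun n => (hDz n).aemeasurable]
    refine ne_top_of_le_ne_top ?_ (ENNReal.tsum_le_tsum fun n =>
      lintegral_walk_pair_le hF hD h n z z₀)
    rw [ENNReal.tsum_mul_right]
    exact ENNReal.mul_ne_top hgeom (hDfin z)
  filter_upwards [hae] with p hp
  have h1 := ENNReal.tendsto_atTop_zero_of_tsum_ne_top hp.ne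
  have h2 : Tendsto (fun n => K * D (walk F n p, walk F n (z₀, p.2))) atTop (𝓝 0) := by
    simpa using ENNReal.Tendsto.const_mul h1 (Or.inr hK)
  have h3 : Tendsto (fun n => edist (walk F n p) (walk F n (z₀, p.2))) atTop (𝓝 0) :=
    tendsto_of_tendsto_of_tendsto_of_le_of_le tendsto_const_nhds h2 (fun _ => zero_le)
      fun n => hDdist _ _
  rw [tendsto_iff_edist_tendsto_0]
  simpa [edist_eq_enorm_sub] using h3

end Contraction

end Polling

/-! ### Contraction in the mean and stability -/

namespace Polling

namespace Visit

variable {N : ℕ} {i : Fin N} {Ω : Type*} [mΩ : MeasurableSpace Ω] {P : Measure Ω}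
  [IsProbabilityMeasure P]

lemma aemeasurable_replacement (V : Visit N i P) (x : ℝ≥0) (j : Fin N) :
    AEMeasurable (fun ω => replacement i V.A V.τ x ω j) P :=
  (V.integrable_replacement x j).1.aestronglyMeasurable.aemeasurable

lemma sum_lintegral_abs_replacement_sub_le (V : Visit N i P) {v w : Fin N → ℝ} {θ c : ℝ}
    (hw : ∀ j, 0 ≤ w j) (hwv : ∀ j, w j ≤ v j)
    (hmean : ∀ (x : ℝ≥0) (j : Fin N), ∫ ω, replacement i V.A V.τ x ω j ∂P
      = (Pi.single i (x : ℝ) : Fin N → ℝ) j + V.rate j * (c * x))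
    (hθ : v i + c * ∑ j, V.rate j * v j ≤ θ * v i) (x y : ℝ≥0) :
    ∑ j, ENNReal.ofReal (w j) * ∫⁻ ω, ENNReal.ofReal
      |replacement i V.A V.τ x ω j - replacement i V.A V.τ y ω j| ∂P
      ≤ ENNReal.ofReal (θ * v i * nndist x y) := by
  set d : ℝ≥0 := nndist x y with hd
  have hnn : ∀ j, 0 ≤ ∫ ω, replacement i V.A V.τ d ω j ∂P := fun j => by
    refine integral_nonneg_of_ae ?_
    filter_upwards [V.replacement_nonneg d] with ω hω
    exact hω j
  simp_rw [V.lintegral_abs_replacement_sub, ← ENNReal.ofReal_mul (hw _)]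
  rw [← ENNReal.ofReal_sum_of_nonneg fun j _ => mul_nonneg (hw j) (hnn j)]
  refine ENNReal.ofReal_le_ofReal ?_
  calc ∑ j, w j * ∫ ω, replacement i V.A V.τ d ω j ∂P
      ≤ ∑ j, v j * ∫ ω, replacement i V.A V.τ d ω j ∂P :=
        Finset.sum_le_sum fun j _ => mul_le_mul_of_nonneg_right (hwv j) (hnn j)
    _ = (v i + c * ∑ j, V.rate j * v j) * d := by
        simp only [hmean, mul_add, Finset.sum_add_distrib, add_mul, Finset.mul_sum,
          Finset.sum_mul]
        congr 1
        · simp [Pi.single_apply]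
        · exact Finset.sum_congr rfl fun j _ => by ring
    _ ≤ θ * v i * d := mul_le_mul_of_nonneg_right hθ d.2

end Visit

namespace PollingSystem

variable {N : ℕ} {Ω Ω' : Fin N → Type*} [∀ i, MeasurableSpace (Ω i)]
  [∀ i, MeasurableSpace (Ω' i)] {P : ∀ i, Measure (Ω i)} {P' : ∀ i, Measure (Ω' i)}
  [∀ i, IsProbabilityMeasure (P i)] [∀ i, IsProbabilityMeasure (P' i)]

lemma workload_ae_eq (Q : PollingSystem P P') (μ : Measure (Fin N → ℝ)) [IsProbabilityMeasure μ] :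
    ∀ᵐ p ∂(pathMeasure P P' μ), ∀ n, walk Q.cycleMap n p = Q.workload n p := by
  have h : ∀ᵐ p ∂(pathMeasure P P' μ), ∀ n, ∀ z, Q.cycleMap (p.2 n, z) = Q.cycle (p.2 n) z := by
    rw [ae_all_iff]
    intro n
    have h1 : ∀ᵐ ω ∂(Measure.infinitePi fun _ : ℕ => cycleMeasure P P'),
        ∀ z, Q.cycleMap (ω n, z) = Q.cycle (ω n) z :=
      (measurePreserving_eval_infinitePi (fun _ : ℕ => cycleMeasure P P')
        n).quasiMeasurePreserving.ae Q.cycleMap_ae_eq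
    exact Measure.quasiMeasurePreserving_snd.ae h1
  filter_upwards [h] with p hp n
  induction n with
  | zero => rfl
  | succ n ih => rw [walk, workload, ih, hp]

lemma lintegral_comp_fst {α β : Type*} [MeasurableSpace α] [MeasurableSpace β] {μ : Measure α}
    {ν : Measure β} [IsProbabilityMeasure μ] [IsProbabilityMeasure ν] {g : α → ℝ≥0∞}
    (hg : AEMeasurable g μ) : ∫⁻ x, g x.1 ∂(μ.prod ν) = ∫⁻ x, g x ∂μ := by
  have hmp : MeasurePreserving Prod.fst (μ.prod ν) μ := measurePreserving_fst
  conv_rhs => rw [← hmp.map_eq]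
  rw [lintegral_map' (by rwa [hmp.map_eq]) measurable_fst.aemeasurable]

lemma switchInput_nonneg (Q : PollingSystem P P') (i : Fin N) :
    ∀ᵐ ω ∂(P' i), 0 ≤ Q.switchInput i ω := by
  filter_upwards [(Q.switch i).subordinator.nonneg] with ω hω
  exact hω _

/-- The weighted `ℓ¹` distance of two workload vectors. -/
noncomputable def weightedDist (w : Fin N → ℝ) (p : (Fin N → ℝ) × (Fin N → ℝ)) : ℝ≥0∞ :=
  ∑ j, ENNReal.ofReal (w j * |p.1 j - p.2 j|)

lemma measurable_weightedDist (w : Fin N → ℝ) : Measurable (weightedDist w) := by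
  unfold weightedDist
  fun_prop

/-- The switch-over input is common to both copies and cancels. The difference in queue `i` is
turned into replacement differences in all queues; weighted by at most `v`, their mean is at most `θ
v_i |z_i - z'_i|`, which is its old weight `w' i`. -/
lemma lintegral_weightedDist_step_le (Q : PollingSystem P P') (i : Fin N)
    {v w w' : Fin N → ℝ} {θ c : ℝ} (hθ0 : 0 ≤ θ) (hv : ∀ j, 0 ≤ v j)
    (hw : ∀ j, 0 ≤ w j) (hwv : ∀ j, w j ≤ v j) (hww' : ∀ j, j ≠ i → w j = w' j)
    (hw'i : w' i = θ * v i)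
    (hmean : ∀ (x : ℝ≥0) (j : Fin N),
      ∫ ω, replacement i (Q.visit i).A (Q.visit i).τ x ω j ∂(P i)
      = (Pi.single i (x : ℝ) : Fin N → ℝ) j + (Q.visit i).rate j * (c * x))
    (hθ : v i + c * ∑ j, (Q.visit i).rate j * v j ≤ θ * v i) (z z' : Fin N → ℝ) :
    ∫⁻ x, weightedDist w (Q.step i (x, z), Q.step i (x, z')) ∂((P i).prod (P' i))
      ≤ weightedDist w' (z, z') := by
  set R : ℝ → Ω i → Fin N → ℝ := fun y ω =>
    replacement i (Q.visit i).A (Q.visit i).τ y.toNNReal ω with hR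
  have hRm : ∀ y j, AEMeasurable (fun ω => R y ω j) (P i) := fun y j =>
    (Q.visit i).aemeasurable_replacement _ j
  set a : Fin N → ℝ≥0∞ := fun j => if j = i then 0 else ENNReal.ofReal (w' j * |z j - z' j|) with ha
  set g : Ω i → ℝ≥0∞ := fun ω => ∑ j, (a j + ENNReal.ofReal (w j) *
    ENNReal.ofReal |R (z i) ω j - R (z' i) ω j|) with hg
  have hgm' : ∀ j, AEMeasurable (fun ω => ENNReal.ofReal |R (z i) ω j - R (z' i) ω j|) (P i) := by
    intro j
    have h1 := hRm (z i) j
    have h2 := hRm (z' i) j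
    exact (measurable_norm.comp_aemeasurable (h1.sub h2)).ennreal_ofReal
  have hgm : AEMeasurable g (P i) :=
    Finset.aemeasurable_fun_sum _ fun j _ => ((hgm' j).const_mul _).const_add _
  have hle : ∫⁻ x, weightedDist w (Q.step i (x, z), Q.step i (x, z')) ∂((P i).prod (P' i))
      ≤ ∫⁻ x, g x.1 ∂((P i).prod (P' i)) := by
    refine lintegral_mono_ae ?_
    filter_upwards [Q.step_ae_eq i] with x hx
    rw [hx z, hx z', weightedDist, hg]
    refine Finset.sum_le_sum fun j _ => ?_
    rw [← ENNReal.ofReal_mul (hw j)]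
    have hdiff : (Q.afterVisit i x.1 z + Q.switchInput i x.2) j
        - (Q.afterVisit i x.1 z' + Q.switchInput i x.2) j
        = (if j = i then 0 else z j - z' j) + (R (z i) x.1 j - R (z' i) x.1 j) := by
      simp only [afterVisit, Pi.add_apply, Pi.sub_apply, hR]
      by_cases hj : j = i
      · subst hj
        simp
      · simp [hj]
        ring
    simp only [hdiff]
    by_cases hj : j = i
    · simp [ha, hj]
    · simp only [ha, hj, if_false]
      rw [← hww' j hj, ← ENNReal.ofReal_add (mul_nonneg (hw j) (abs_nonneg _))
        (mul_nonneg (hw j) (abs_nonneg _)), ← mul_add]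
      exact ENNReal.ofReal_le_ofReal (mul_le_mul_of_nonneg_left (abs_add_le _ _) (hw j))
  refine hle.trans ?_
  rw [lintegral_comp_fst hgm, hg,
    lintegral_finsetSum' _ fun j _ => ((hgm' j).const_mul _).const_add _]
  have hsplit : ∀ j, ∫⁻ ω, (a j + ENNReal.ofReal (w j) *
      ENNReal.ofReal |R (z i) ω j - R (z' i) ω j|) ∂(P i) = a j + ENNReal.ofReal (w j) *
      ∫⁻ ω, ENNReal.ofReal |R (z i) ω j - R (z' i) ω j| ∂(P i) := by
    intro j
    rw [lintegral_add_left measurable_const, lintegral_const_mul'' _ (hgm' j)]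
    simp
  simp only [hsplit]
  rw [Finset.sum_add_distrib]
  have h1 := (Q.visit i).sum_lintegral_abs_replacement_sub_le hw hwv hmean hθ
    (z i).toNNReal (z' i).toNNReal
  have h2 : ENNReal.ofReal (θ * v i * nndist (z i).toNNReal (z' i).toNNReal)
      ≤ ENNReal.ofReal (w' i * |z i - z' i|) := by
    rw [hw'i]
    refine ENNReal.ofReal_le_ofReal (mul_le_mul_of_nonneg_left ?_ (mul_nonneg hθ0 (hv i)))
    -- Taking positive parts is a contraction, so the estimate also holds for vectors outside the
    -- orthant.
    rw [coe_nndist, NNReal.dist_eq, Real.coe_toNNReal', Real.coe_toNNReal']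
    exact abs_max_sub_max_le_abs _ _ _
  have h3 : ∑ j, a j + ENNReal.ofReal (w' i * |z i - z' i|) = weightedDist w' (z, z') := by
    rw [weightedDist, ← Finset.sum_erase_add _ _ (Finset.mem_univ i), ← Finset.sum_erase_add
      (a := i) Finset.univ (fun j => ENNReal.ofReal (w' j * |z j - z' j|)) (Finset.mem_univ i)]
    simp only [ha, if_true, add_zero]
    congr 1
    exact Finset.sum_congr rfl fun j hj => by rw [if_neg (Finset.ne_of_mem_erase hj)]
  rw [← h3]
  gcongr
  exact h1.trans h2

/-- If a positive weight vector has negative drift during every visit, the weighted distance of two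
workload vectors that are driven by the same randomness contracts in the mean. -/
lemma exists_contraction (Q : PollingSystem P P') [Nonempty (Fin N)] {v : Fin N → ℝ}
    (hv : ∀ j, 0 < v j) (hdrift : ∀ i, ∑ j, (Q.visit i).rate j * v j < 0) :
    ∃ θ : ℝ≥0∞, θ < 1 ∧ ∀ z z', ∫⁻ ω, weightedDist v (Q.cycleMap (ω, z), Q.cycleMap (ω, z'))
      ∂(cycleMeasure P P') ≤ θ * weightedDist v (z, z') := by
  choose c hc hmean using fun i => (Q.visit i).exists_mean
  set r : Fin N → ℝ := fun i => (v i + c i * ∑ j, (Q.visit i).rate j * v j) / v i with hr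
  have hr1 : ∀ i, r i < 1 := fun i => by
    rw [hr]
    simp only
    rw [div_lt_one (hv i)]
    nlinarith [hc i, hdrift i]
  -- The value `1/2` only serves to keep `θ` positive.
  set θ : ℝ := max 2⁻¹ (Finset.univ.sup' Finset.univ_nonempty r) with hθdef
  have hθ0 : 0 < θ := lt_of_lt_of_le (by norm_num) (le_max_left _ _)
  have hθ1 : θ < 1 := max_lt (by norm_num) ((Finset.sup'_lt_iff _).2 fun i _ => hr1 i)
  have hθ : ∀ i, v i + c i * ∑ j, (Q.visit i).rate j * v j ≤ θ * v i := fun i => by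
    rw [← div_le_iff₀ (hv i)]
    exact (Finset.le_sup' r (Finset.mem_univ i)).trans (le_max_right _ _)
  refine ⟨ENNReal.ofReal θ, ENNReal.ofReal_lt_one.2 hθ1, fun z z' => ?_⟩
  -- `s` is the set of queues already visited. A visit raises the weight of its queue from `θ v_i`
  -- to `v_i`, paid for by the negative drift; since every queue is visited once, a cycle leads from
  -- `θ v` to `v`.
  set w : Finset (Fin N) → Fin N → ℝ := fun s j => if j ∈ s then v j else θ * v j with hw
  have hwnn : ∀ s j, 0 ≤ w s j := fun s j => by
    rw [hw]
    simp only
    split_ifs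
    exacts [(hv j).le, (mul_pos hθ0 (hv j)).le]
  have hwv : ∀ s j, w s j ≤ v j := fun s j => by
    rw [hw]
    simp only
    split_ifs
    exacts [le_rfl, mul_le_of_le_one_left (hv j).le hθ1.le]
  have h := Q.lintegral_cycleMap_pair_le (V := fun s => weightedDist (w s))
    (fun s => measurable_weightedDist _) (fun i s hi z z' =>
      Q.lintegral_weightedDist_step_le i hθ0.le (fun j => (hv j).le) (hwnn _) (hwv _)
        (fun j hj => by simp [hw, hj]) (by simp [hw, hi]) (hmean i) (hθ i) z z') z z'
  have hu : w Finset.univ = v := by ext j; simp [hw]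
  have he : weightedDist (w ∅) (z, z') = ENNReal.ofReal θ * weightedDist v (z, z') := by
    simp only [weightedDist, hw, Finset.mul_sum, Finset.notMem_empty, if_false]
    refine Finset.sum_congr rfl fun j _ => ?_
    rw [← ENNReal.ofReal_mul hθ0.le, mul_assoc]
  rwa [hu, he] at h

/-- Invariance of the orthant, written as a drift inequality for a function that is `0` on it and
`∞` outside, so that the general drift criteria apply. -/
lemma lintegral_cycleMap_not_nonneg (Q : PollingSystem P P') (z : Fin N → ℝ) :
    ∫⁻ ω, {y : Fin N → ℝ | 0 ≤ y}ᶜ.indicator (fun _ => ∞) (Q.cycleMap (ω, z))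
      ∂(cycleMeasure P P') ≤ {y : Fin N → ℝ | 0 ≤ y}ᶜ.indicator (fun _ => ∞) z := by
  have hm : MeasurableSet {y : Fin N → ℝ | 0 ≤ y}ᶜ := (measurableSet_Ici (a := 0)).compl
  refine Q.lintegral_cycleMap_le
    (V := fun _ => {y : Fin N → ℝ | 0 ≤ y}ᶜ.indicator (fun _ => ∞))
    (fun _ => measurable_const.indicator hm) (fun i s _ z => ?_) z
  by_cases hz : 0 ≤ z
  · rw [Set.indicator_of_notMem (by simpa using hz), nonpos_iff_eq_zero]
    refine lintegral_eq_zero_of_ae_eq_zero ?_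
    filter_upwards [Q.step_ae_eq i,
      Measure.quasiMeasurePreserving_fst.ae ((Q.visit i).replacement_nonneg (z i).toNNReal),
      Measure.quasiMeasurePreserving_snd.ae (Q.switchInput_nonneg i)] with x h1 h2 h3
    have : (0 : Fin N → ℝ) ≤ Q.step i (x, z) := by
      rw [h1, afterVisit]
      refine add_nonneg (add_nonneg (fun j => ?_) h2) h3
      by_cases hj : j = i
      · subst hj
        simp
      · simpa [hj] using hz j
    exact Set.indicator_of_notMem (by simpa using this) _
  · rw [Set.indicator_of_mem (by simpa using hz)]
    exact le_top

/-- A polling system with integrable immigration is stable if some positive weight vector has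
negative drift during every visit. -/
theorem stable_of_drift_neg (Q : PollingSystem P P') [Nonempty (Fin N)] {v : Fin N → ℝ}
    (hv : ∀ j, 0 < v j) (hdrift : ∀ i, ∑ j, (Q.visit i).rate j * v j < 0)
    (himm : Q.IntegrableImmigration) : Q.Stable := by
  obtain ⟨θ, hθ, hcontr⟩ := Q.exists_contraction hv hdrift
  have hK : ∑ j, ENNReal.ofReal (v j)⁻¹ ≠ ∞ := by simp
  have hDdist : ∀ z z' : Fin N → ℝ,
      edist z z' ≤ (∑ j, ENNReal.ofReal (v j)⁻¹) * weightedDist v (z, z') := by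
    intro z z'
    refine edist_pi_le_iff.2 fun j => ?_
    calc edist (z j) (z' j) = ENNReal.ofReal (v j)⁻¹ * ENNReal.ofReal (v j * |z j - z' j|) := by
          rw [← ENNReal.ofReal_mul (inv_nonneg.2 (hv j).le), inv_mul_cancel_left₀ (hv j).ne',
            edist_dist, Real.dist_eq]
      _ ≤ _ := by
          gcongr
          · exact Finset.single_le_sum (f := fun j => ENNReal.ofReal (v j)⁻¹)
              (fun _ _ => zero_le) (Finset.mem_univ j)
          · exact Finset.single_le_sum (f := fun j => ENNReal.ofReal (v j * |z j - z' j|))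
              (fun _ _ => zero_le) (Finset.mem_univ j)
  have hDfin : ∀ z : Fin N → ℝ, weightedDist v (z, 0) ≠ ∞ := fun z => by simp [weightedDist]
  have h0 : ∫⁻ ω, weightedDist v (Q.cycleMap (ω, 0), 0) ∂(cycleMeasure P P') ≠ ∞ := by
    refine ne_top_of_le_ne_top (b := ∫⁻ ω, (∑ j, ENNReal.ofReal (v j)) * ‖Q.cycle ω 0‖ₑ
      ∂(cycleMeasure P P')) ?_ (lintegral_mono_ae ?_)
    · rw [lintegral_const_mul' _ _ (by simp)]
      exact ENNReal.mul_ne_top (by simp) himm.2.ne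
    · filter_upwards [Q.cycleMap_ae_eq] with ω hω
      rw [hω, weightedDist, Finset.sum_mul]
      refine Finset.sum_le_sum fun j _ => ?_
      rw [ENNReal.ofReal_mul (hv j).le]
      gcongr
      rw [← ofReal_norm]
      refine ENNReal.ofReal_le_ofReal ?_
      simpa using norm_le_pi_norm (Q.cycle ω 0) j
  obtain ⟨Z, hZm, hZ, hwalk⟩ := exists_tendstoInDistribution_walk Q.measurable_cycleMap
    (measurable_weightedDist v) hK hDdist hDfin hθ hcontr h0
  set ν := Measure.infinitePi fun _ : ℕ => cycleMeasure P P' with hν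
  have hm : MeasurableSet {y : Fin N → ℝ | 0 ≤ y} := measurableSet_Ici (a := 0)
  -- The backward iterates from `0` have the laws of the forward ones, so they stay in the orthant,
  -- which is closed.
  have hZnn : ∀ᵐ ω ∂ν, 0 ≤ Z ω := by
    have hback : ∀ᵐ ω ∂ν, ∀ n, 0 ≤ backwardWalk Q.cycleMap 0 n ω := by
      rw [ae_all_iff]
      intro n
      have hfm : Measurable ({y : Fin N → ℝ | 0 ≤ y}ᶜ.indicator (fun _ => (∞ : ℝ≥0∞))) :=
        measurable_const.indicator hm.compl
      have h1 := lintegral_backwardWalk (m := cycleMeasure P P') Q.measurable_cycleMap 0 n hfm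
      have h2 := lintegral_walk_le (m := cycleMeasure P P') Q.measurable_cycleMap hfm (γ := 1)
        (fun z => by rw [one_mul]; exact Q.lintegral_cycleMap_not_nonneg z) n 0
      rw [lintegral_walk Q.measurable_cycleMap n hfm, ← h1, Set.indicator_of_notMem (by simp),
        mul_zero, nonpos_iff_eq_zero] at h2
      have h3 := (lintegral_eq_zero_iff
        (hfm.comp (measurable_backwardWalk Q.measurable_cycleMap 0 n))).1 h2
      filter_upwards [h3] with ω hω
      by_contra hneg
      rw [Function.comp_apply, Set.indicator_of_mem (by simpa using hneg)] at hω
      simp at hω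
    filter_upwards [hback, hZ] with ω h1 h2
    exact ge_of_tendsto' h2 h1
  obtain ⟨π, hπ⟩ : ∃ π : ProbabilityMeasure (Fin N → ℝ), (π : Measure (Fin N → ℝ)) = ν.map Z :=
    ⟨⟨ν.map Z, Measure.isProbabilityMeasure_map hZm.aemeasurable⟩, rfl⟩
  refine ⟨π, ?_, fun μ _ => ?_⟩
  · rw [hπ]
    exact (ae_map_iff hZm.aemeasurable hm).2 hZnn
  · have h1 := hwalk (μ : Measure (Fin N → ℝ))
    have hae : ∀ n, walk Q.cycleMap n =ᵐ[pathMeasure P P' (μ : Measure (Fin N → ℝ))]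
        Q.workload n := fun n => by
      filter_upwards [Q.workload_ae_eq (μ : Measure (Fin N → ℝ))] with p hp
      exact hp n
    refine ⟨fun n => ?_, aemeasurable_id, ?_⟩
    · exact (h1.forall_aemeasurable n).congr (hae n)
    · have h2 := h1.tendsto
      have hlim : (⟨ν.map Z, Measure.isProbabilityMeasure_map hZm.aemeasurable⟩ :
          ProbabilityMeasure (Fin N → ℝ)) = ⟨(π : Measure (Fin N → ℝ)).map fun z => z,
            Measure.isProbabilityMeasure_map aemeasurable_id⟩ :=
        Subtype.ext (by simp [hπ])
      rw [hlim] at h2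
      refine h2.congr fun n => Subtype.ext ?_
      exact Measure.map_congr (hae n)

end PollingSystem

end Polling

/-! ### Exponential drift and instability -/

namespace Polling

namespace PollingSystem

variable {N : ℕ} {Ω Ω' : Fin N → Type*} [∀ i, MeasurableSpace (Ω i)]
  [∀ i, MeasurableSpace (Ω' i)] {P : ∀ i, Measure (Ω i)} {P' : ∀ i, Measure (Ω' i)}
  [∀ i, IsProbabilityMeasure (P i)] [∀ i, IsProbabilityMeasure (P' i)]

lemma aemeasurable_switchInput (Q : PollingSystem P P') (i : Fin N) :
    AEMeasurable (Q.switchInput i) (P' i) := by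
  obtain ⟨W', hW'm, hW'⟩ := (Q.switch i).subordinator.levy.exists_measurable_version
  refine ⟨fun ω => W' ((Q.switch i).S ω) ω,
    hW'm.comp ((Q.switch i).measurable_S.prodMk measurable_id), ?_⟩
  filter_upwards [hW'] with ω hω
  exact (hω _).symm

/-- The exponential of minus the weighted total workload. -/
noncomputable def expWeight (w : Fin N → ℝ) (z : Fin N → ℝ) : ℝ≥0∞ :=
  ENNReal.ofReal (Real.exp (-∑ j, w j * z j))

lemma measurable_expWeight (w : Fin N → ℝ) : Measurable (expWeight w) := by
  unfold expWeight
  fun_prop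

lemma expWeight_le_one {w z : Fin N → ℝ} (hw : ∀ j, 0 ≤ w j) (hz : 0 ≤ z) :
    expWeight w z ≤ 1 := by
  rw [expWeight, ENNReal.ofReal_le_one, Real.exp_le_one_iff]
  exact neg_nonpos.2 (Finset.sum_nonneg fun j _ => mul_nonneg (hw j) (hz j))

lemma lintegral_expWeight_switchInput_le_one (Q : PollingSystem P P') (i : Fin N)
    {w : Fin N → ℝ} (hw : ∀ j, 0 ≤ w j) :
    ∫⁻ ω, expWeight w (Q.switchInput i ω) ∂(P' i) ≤ 1 := by
  calc ∫⁻ ω, expWeight w (Q.switchInput i ω) ∂(P' i) ≤ ∫⁻ _, 1 ∂(P' i) := by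
        refine lintegral_mono_ae ?_
        filter_upwards [Q.switchInput_nonneg i] with ω hω
        exact expWeight_le_one hw hω
    _ = 1 := by simp

lemma lintegral_expWeight_switchInput_lt_one (Q : PollingSystem P P') {i : Fin N}
    {w : Fin N → ℝ} (hw : ∀ j, 0 < w j) (hne : ¬ ∀ᵐ ω ∂(P' i), Q.switchInput i ω = 0) :
    ∫⁻ ω, expWeight w (Q.switchInput i ω) ∂(P' i) < 1 := by
  have hle := Q.lintegral_expWeight_switchInput_le_one i fun j => (hw j).le
  have hlt : ∫⁻ ω, expWeight w (Q.switchInput i ω) ∂(P' i) < ∫⁻ _, 1 ∂(P' i) := by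
    refine lintegral_strict_mono_of_ae_le_of_ae_lt_on (s := {ω | ¬ Q.switchInput i ω = 0})
      aemeasurable_const (ne_top_of_le_ne_top ENNReal.one_ne_top hle) ?_ hne ?_
    · filter_upwards [Q.switchInput_nonneg i] with ω hω
      exact expWeight_le_one (fun j => (hw j).le) hω
    · filter_upwards [Q.switchInput_nonneg i] with ω hω hmem
      rw [expWeight, ENNReal.ofReal_lt_one, Real.exp_lt_one_iff, neg_lt_zero]
      obtain ⟨k, hk⟩ : ∃ k, Q.switchInput i ω k ≠ 0 := by
        by_contra! h
        exact hmem (funext h)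
      exact Finset.sum_pos' (fun j _ => mul_nonneg (hw j).le (hω j))
        ⟨k, Finset.mem_univ k, mul_pos (hw k) (lt_of_le_of_ne (hω k) (Ne.symm hk))⟩
  simpa using hlt

/-- Visit and switch-over period are independent, so the expectation factorizes: the visit
contributes at most `1`, the switch-over period its Laplace transform. -/
lemma lintegral_expWeight_step_le (Q : PollingSystem P P') (i : Fin N) {v : Fin N → ℝ} {ε : ℝ}
    (hε : 0 ≤ ε) (hv : ∀ j, 0 ≤ v j)
    (h : ∀ x : ℝ≥0, ∫⁻ ω, ENNReal.ofReal (Real.exp (-(ε * (∑ j, v j *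
      replacement i (Q.visit i).A (Q.visit i).τ x ω j - v i * x)))) ∂(P i) ≤ 1)
    (z : Fin N → ℝ) :
    ∫⁻ x, expWeight (fun j => ε * v j) (Q.step i (x, z)) ∂((P i).prod (P' i))
      ≤ (∫⁻ ω, expWeight (fun j => ε * v j) (Q.switchInput i ω) ∂(P' i))
        * expWeight (fun j => ε * v j) z := by
  set w : Fin N → ℝ := fun j => ε * v j with hw
  set g : Ω i → ℝ≥0∞ := fun ω => ENNReal.ofReal (Real.exp (-(ε * (∑ j, v j *
      replacement i (Q.visit i).A (Q.visit i).τ (z i).toNNReal ω j - v i * (z i).toNNReal)))) with hg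
  have hgm : AEMeasurable g (P i) := by
    have := fun j => (Q.visit i).aemeasurable_replacement (z i).toNNReal j
    fun_prop
  have hsm : AEMeasurable (fun ω => expWeight w (Q.switchInput i ω)) (P' i) :=
    (measurable_expWeight w).comp_aemeasurable (Q.aemeasurable_switchInput i)
  have hpt : ∀ᵐ x ∂((P i).prod (P' i)), expWeight w (Q.step i (x, z))
      ≤ expWeight w z * (g x.1 * expWeight w (Q.switchInput i x.2)) := by
    filter_upwards [Q.step_ae_eq i] with x hx
    rw [hx]
    simp only [expWeight, hg]
    rw [← ENNReal.ofReal_mul (Real.exp_nonneg _), ← ENNReal.ofReal_mul (Real.exp_nonneg _),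
      ← Real.exp_add, ← Real.exp_add]
    refine ENNReal.ofReal_le_ofReal (Real.exp_le_exp.2 ?_)
    have h1 : ∑ j, w j * (Q.afterVisit i x.1 z + Q.switchInput i x.2) j
        = ∑ j, w j * z j - w i * z i + ε * ∑ j, v j * replacement i (Q.visit i).A (Q.visit i).τ
          (z i).toNNReal x.1 j + ∑ j, w j * Q.switchInput i x.2 j := by
      have h2 : ∑ j, w j * (Pi.single i (z i) : Fin N → ℝ) j = w i * z i := by
        simp [Pi.single_apply]
      rw [← h2, Finset.mul_sum, ← Finset.sum_sub_distrib, ← Finset.sum_add_distrib,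
        ← Finset.sum_add_distrib]
      refine Finset.sum_congr rfl fun j _ => ?_
      simp only [afterVisit, Pi.add_apply, Pi.sub_apply, hw]
      ring
    rw [h1]
    have h3 : z i ≤ ((z i).toNNReal : ℝ) := Real.le_coe_toNNReal _
    have h4 : w i * z i ≤ ε * (v i * (z i).toNNReal) := by
      rw [hw, mul_assoc]
      exact mul_le_mul_of_nonneg_left (mul_le_mul_of_nonneg_left h3 (hv i)) hε
    linarith
  calc ∫⁻ x, expWeight w (Q.step i (x, z)) ∂((P i).prod (P' i))
      ≤ ∫⁻ x, expWeight w z * (g x.1 * expWeight w (Q.switchInput i x.2)) ∂((P i).prod (P' i)) :=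
        lintegral_mono_ae hpt
    _ = expWeight w z * ((∫⁻ ω, g ω ∂(P i)) * ∫⁻ ω, expWeight w (Q.switchInput i ω) ∂(P' i)) := by
        rw [lintegral_const_mul' _ _ (show expWeight w z ≠ ∞ from ENNReal.ofReal_ne_top),
          lintegral_prod_mul hgm hsm]
    _ ≤ expWeight w z * (1 * ∫⁻ ω, expWeight w (Q.switchInput i ω) ∂(P' i)) := by
        gcongr
        exact h _
    _ = _ := by rw [one_mul, mul_comm]

/-- A polling system with nonzero switch-over input is unstable if some positive weight vector has
positive drift during every visit. -/
theorem unstable_of_drift_pos (Q : PollingSystem P P') [Nonempty (Fin N)] {v : Fin N → ℝ}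
    (hv : ∀ j, 0 < v j) (hdrift : ∀ i, 0 < ∑ j, (Q.visit i).rate j * v j)
    (hne : ∃ i, ¬ ∀ᵐ ω ∂(P' i), Q.switchInput i ω = 0) : Q.Unstable := by
  obtain ⟨ε, hε, hε0⟩ := ((eventually_all.2 fun i =>
    (Q.visit i).eventually_lintegral_exp_le hv (hdrift i)).and self_mem_nhdsWithin).exists
  have hε0 : 0 < ε := hε0
  set w : Fin N → ℝ := fun j => ε * v j with hw
  have hwpos : ∀ j, 0 < w j := fun j => mul_pos hε0 (hv j)
  set γ : Fin N → ℝ≥0∞ := fun i => ∫⁻ ω, expWeight w (Q.switchInput i ω) ∂(P' i) with hγ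
  have hγ1 : ∀ i, γ i ≤ 1 := fun i =>
    Q.lintegral_expWeight_switchInput_le_one i fun j => (hwpos j).le
  have hprod : ∏ i, γ i < 1 := by
    obtain ⟨i, hi⟩ := hne
    rw [← Finset.mul_prod_erase _ _ (Finset.mem_univ i)]
    exact (mul_le_of_le_one_right zero_le (Finset.prod_le_one' fun j _ => hγ1 j)).trans_lt
      (Q.lintegral_expWeight_switchInput_lt_one hwpos hi)
  have hcycle : ∀ z, ∫⁻ ω, expWeight w (Q.cycleMap (ω, z)) ∂(cycleMeasure P P')
      ≤ (∏ i, γ i) * expWeight w z := by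
    intro z
    -- The product runs over the switch-over periods still to come; each step consumes one factor.
    have h := Q.lintegral_cycleMap_le (V := fun s y => (∏ j ∈ sᶜ, γ j) * expWeight w y)
      (fun s => (measurable_expWeight w).const_mul _) (fun i s hi y => ?_) z
    · simpa using h
    · have hmy : Measurable fun x => expWeight w (Q.step i (x, y)) :=
        (measurable_expWeight w).comp
          ((Q.measurable_step i).comp (measurable_id.prodMk measurable_const))
      rw [lintegral_const_mul _ hmy]
      refine (mul_le_mul_right (Q.lintegral_expWeight_step_le i hε0.le (fun j => (hv j).le)
        (hε i) y) _).trans (le_of_eq ?_)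
      rw [← mul_assoc, Finset.compl_insert, Finset.prod_erase_mul _ _ (by simpa using hi)]
  intro μ _
  have hwm := fun n => measurable_walk Q.measurable_cycleMap n
  have hm : ∀ n, Measurable fun p => expWeight w (walk Q.cycleMap n p) := fun n =>
    (measurable_expWeight w).comp (hwm n)
  -- For a fixed start the expected sum is bounded by a geometric series. An almost surely finite
  -- sum has terms tending to `0`, which forces the weighted workload to infinity.
  have hae : ∀ᵐ p ∂(pathMeasure P P' (μ : Measure (Fin N → ℝ))),
      ∑' n, expWeight w (walk Q.cycleMap n p) < ∞ := by
    rw [pathMeasure, Measure.ae_prod_iff_ae_ae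
      (measurableSet_lt (Measurable.tsum hm) measurable_const)]
    refine Eventually.of_forall fun z => ?_
    have hmz : ∀ n, Measurable fun ω => expWeight w (walk Q.cycleMap n (z, ω)) :=
      fun n => (hm n).comp (measurable_const.prodMk measurable_id)
    refine ae_lt_top (Measurable.tsum hmz) ?_
    rw [lintegral_tsum fun n => (hmz n).aemeasurable]
    refine ne_top_of_le_ne_top ?_ (ENNReal.tsum_le_tsum fun n =>
      lintegral_walk_le Q.measurable_cycleMap (measurable_expWeight w) hcycle n z)
    rw [ENNReal.tsum_mul_right, ENNReal.tsum_geometric]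
    exact ENNReal.mul_ne_top (ENNReal.inv_ne_top.2 (tsub_pos_of_lt hprod).ne')
      ENNReal.ofReal_ne_top
  filter_upwards [hae, Q.workload_ae_eq (μ : Measure (Fin N → ℝ))] with p hp hwalk
  have hlim := ENNReal.tendsto_atTop_zero_of_tsum_ne_top hp.ne
  have hW : 0 < ∑ j, w j := Finset.sum_pos (fun j _ => hwpos j) Finset.univ_nonempty
  refine tendsto_atTop.2 fun b => ?_
  have hev := hlim.eventually (gt_mem_nhds (show (0 : ℝ≥0∞)
    < ENNReal.ofReal (Real.exp (-((∑ j, w j) * b))) by simp [Real.exp_pos]))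
  filter_upwards [hev] with n hn
  rw [expWeight, ENNReal.ofReal_lt_ofReal_iff (Real.exp_pos _), Real.exp_lt_exp, neg_lt_neg_iff,
    hwalk n] at hn
  have h1 : ∑ j, w j * Q.workload n p j ≤ (∑ j, w j) * ‖Q.workload n p‖ := by
    rw [Finset.sum_mul]
    exact Finset.sum_le_sum fun j _ => mul_le_mul_of_nonneg_left
      ((le_abs_self _).trans (norm_le_pi_norm (Q.workload n p) j)) (hwpos j).le
  exact (lt_of_mul_lt_mul_left (hn.trans_le h1) hW.le).le

lemma NonzeroSwitchInput.exists {Q : PollingSystem P P'} (h : Q.NonzeroSwitchInput) :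
    ∃ i, ¬ ∀ᵐ ω ∂(P' i), Q.switchInput i ω = 0 := by
  by_contra! hall
  refine h ?_
  have h1 : ∀ᵐ ω ∂(cycleMeasure P P'), ∀ i, Q.switchInput i (ω i).2 = 0 := by
    rw [ae_all_iff]
    intro i
    exact (measurePreserving_eval (fun i => (P i).prod (P' i)) i).quasiMeasurePreserving.ae
      (Measure.quasiMeasurePreserving_snd.ae (hall i))
  filter_upwards [h1] with ω hω
  exact Finset.sum_eq_zero fun i _ => hω i

/-- A stable system is not unstable. -/
lemma Stable.not_unstable {Q : PollingSystem P P'} (hst : Q.Stable) : ¬ Q.Unstable := by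
  intro hun
  obtain ⟨π, -, hπ⟩ := hst
  set μ : ProbabilityMeasure (Fin N → ℝ) := ⟨Measure.dirac 0, inferInstance⟩ with hμ
  have hμ0 : ∀ᵐ z ∂(μ : Measure (Fin N → ℝ)), 0 ≤ z := by
    change ∀ᵐ z ∂(Measure.dirac (0 : Fin N → ℝ)), 0 ≤ z
    rw [ae_dirac_iff (measurableSet_Ici (a := 0))]
  have hconv := hπ μ hμ0
  have hinf := hun μ hμ0
  -- A positive test function vanishing at infinity: its integrals tend to `0` when the workload
  -- escapes, but to a positive number under convergence in distribution.
  let f : BoundedContinuousFunction (Fin N → ℝ) ℝ :=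
    BoundedContinuousFunction.ofNormedAddCommGroup (fun z => Real.exp (-‖z‖)) (by fun_prop) 1
      fun z => by
        rw [Real.norm_of_nonneg (Real.exp_nonneg _), Real.exp_le_one_iff]
        exact neg_nonpos.2 (norm_nonneg z)
  have hf : ∀ z, f z = Real.exp (-‖z‖) := fun z => rfl
  have h1 := (ProbabilityMeasure.tendsto_iff_forall_integral_tendsto.1 hconv.tendsto) f
  simp only [ProbabilityMeasure.coe_mk] at h1
  rw [show (fun z : Fin N → ℝ => z) = id from rfl, Measure.map_id] at h1
  have h2 : Tendsto (fun n => ∫ p, f (Q.workload n p)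
      ∂(pathMeasure P P' (μ : Measure (Fin N → ℝ)))) atTop (𝓝 (∫ _, (0 : ℝ)
      ∂(pathMeasure P P' (μ : Measure (Fin N → ℝ))))) := by
    refine tendsto_integral_of_dominated_convergence (fun _ => 1) (fun n => ?_)
      (integrable_const _) (fun n => Eventually.of_forall fun p => ?_) ?_
    · exact (f.continuous.measurable.comp_aemeasurable
        (hconv.forall_aemeasurable n)).aestronglyMeasurable
    · rw [hf, Real.norm_of_nonneg (Real.exp_nonneg _), Real.exp_le_one_iff]
      exact neg_nonpos.2 (norm_nonneg _)
    · filter_upwards [hinf] with p hp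
      simp only [hf]
      exact Real.tendsto_exp_neg_atTop_nhds_zero.comp hp
  have h3 : ∀ n, ∫ z, f z ∂((pathMeasure P P' (μ : Measure (Fin N → ℝ))).map (Q.workload n))
      = ∫ p, f (Q.workload n p) ∂(pathMeasure P P' (μ : Measure (Fin N → ℝ))) := fun n =>
    integral_map (hconv.forall_aemeasurable n) f.continuous.measurable.aestronglyMeasurable
  simp only [h3] at h1
  have h4 := tendsto_nhds_unique h1 h2
  have h5 : 0 < ∫ z, f z ∂(π : Measure (Fin N → ℝ)) := by
    simp only [hf]
    refine integral_exp_pos ?_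
    refine Integrable.of_bound (C := 1) (by fun_prop) (Eventually.of_forall fun z => ?_)
    rw [Real.norm_of_nonneg (Real.exp_nonneg _), Real.exp_le_one_iff]
    exact neg_nonpos.2 (norm_nonneg z)
  rw [h4] at h5
  simp at h5

/-- In the standard model the rate matrix is determined by the input rates. -/
lemma IsStandard.rate_eq {Q : PollingSystem P P'} (h : Q.IsStandard) (i j : Fin N) :
    (Q.visit i).rate j = Q.inputRate j - (Pi.single i (1 : ℝ) : Fin N → ℝ) j := by
  have h1 := ((h.same_law i j 1).comp (measurable_pi_apply j)).integral_eq
  simp only [Function.comp_apply, Pi.add_apply] at h1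
  rw [integral_add ((Q.visit i).integrable j) (integrable_const _)] at h1
  simp only [integral_const, probReal_univ, one_smul, NNReal.coe_one] at h1
  exact eq_sub_of_add_eq h1

/-- If the input over the period vanished, monotonicity would give `W δ = 0` on `S > δ`.
Independence of `S` and `P (S > δ) > 0` extend this to almost all outcomes, and stationary
increments carry it to `W 1 = 0`, against the nonzero rate. -/
lemma switchInput_ne_zero_of_inputRate_ne_zero (Q : PollingSystem P P') {j : Fin N}
    (hj : Q.inputRate j ≠ 0) : ¬ ∀ᵐ ω ∂(P' j), Q.switchInput j ω = 0 := by
  intro h0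
  set W := (Q.switch j).W with hW
  set S := (Q.switch j).S with hS
  have hsub := (Q.switch j).subordinator
  obtain ⟨n, hn⟩ : ∃ n : ℕ, P' j {ω | ((n : ℝ≥0) + 1)⁻¹ < S ω} ≠ 0 := by
    by_contra! hall
    have h1 : ∀ᵐ ω ∂(P' j), ∀ n : ℕ, ¬ ((n : ℝ≥0) + 1)⁻¹ < S ω :=
      ae_all_iff.2 fun n => measure_eq_zero_iff_ae_notMem.1 (hall n)
    obtain ⟨ω, hω1, hω2⟩ := (h1.and (Q.switch j).S_pos).exists
    obtain ⟨n, hn⟩ := exists_nat_one_div_lt (hω2 : 0 < S ω)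
    exact hω1 n (by rwa [one_div] at hn)
  -- A reciprocal of an integer, so that `n + 1` increments of length `δ` reach time `1` exactly.
  set δ : ℝ≥0 := ((n : ℝ≥0) + 1)⁻¹ with hδ
  have hm0 : MeasurableSet ({0}ᶜ : Set (Fin N → ℝ)) := (measurableSet_singleton 0).compl
  have hδ0 : ∀ᵐ ω ∂(P' j), W δ ω = 0 := by
    have hind : IndepFun S (W δ) (P' j) :=
      (Q.switch j).indep.comp measurable_id (measurable_pi_apply δ)
    have h1 := hind.measure_inter_preimage_eq_mul (Set.Ioi δ) {0}ᶜ measurableSet_Ioi hm0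
    have h2 : P' j (S ⁻¹' Set.Ioi δ ∩ W δ ⁻¹' {0}ᶜ) = 0 := by
      have : ∀ᵐ ω ∂(P' j), ω ∉ S ⁻¹' Set.Ioi δ ∩ W δ ⁻¹' {0}ᶜ := by
        filter_upwards [h0, hsub.monotone, hsub.nonneg] with ω hω hmono hnn
        rintro ⟨h3, h4⟩
        refine h4 (le_antisymm ?_ (hnn δ))
        rw [← hω]
        exact hmono (le_of_lt h3)
      exact measure_eq_zero_iff_ae_notMem.2 this
    rw [h2] at h1
    have h3 := (mul_eq_zero.1 h1.symm).resolve_left hn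
    exact (measure_eq_zero_iff_ae_notMem.1 h3).mono fun ω hω => by simpa using hω
  have hk : ∀ k : ℕ, ∀ᵐ ω ∂(P' j), W (k * δ) ω = 0 := by
    intro k
    induction k with
    | zero => simpa using hsub.levy.zero
    | succ k ih =>
      have h1 : ∀ᵐ ω ∂(P' j), W (k * δ + δ) ω - W (k * δ) ω = 0 :=
        (hsub.levy.stationary (k * δ) δ).symm.ae_snd (p := fun z => z = 0)
          (measurableSet_singleton 0) hδ0
      filter_upwards [ih, h1] with ω h2 h3
      push_cast
      rw [add_mul, one_mul]
      rw [h2, sub_zero] at h3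
      exact h3
  have h1 := hk (n + 1)
  have hone : ((n + 1 : ℕ) : ℝ≥0) * δ = 1 := by
    rw [hδ]
    push_cast
    exact mul_inv_cancel₀ (by positivity)
  rw [hone] at h1
  apply hj
  rw [inputRate]
  refine integral_eq_zero_of_ae ?_
  filter_upwards [h1] with ω hω
  have := congrFun hω j
  exact this

end PollingSystem

end Polling

/-! ### From the eigenvalue and the input rates to the drift conditions -/

namespace Polling

namespace PollingSystem

variable {N : ℕ} {Ω Ω' : Fin N → Type*} [∀ i, MeasurableSpace (Ω i)]
  [∀ i, MeasurableSpace (Ω' i)] {P : ∀ i, Measure (Ω i)} {P' : ∀ i, Measure (Ω' i)}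
  [∀ i, IsProbabilityMeasure (P i)] [∀ i, IsProbabilityMeasure (P' i)]

theorem stable_of_perronEigenvalue_neg (Q : PollingSystem P P') [Nonempty (Fin N)]
    (h : perronEigenvalue Q.rateMatrix < 0) (himm : Q.IntegrableImmigration) : Q.Stable := by
  obtain ⟨v, hv, hAv⟩ := exists_pos_mulVec_neg_of_perronEigenvalue_neg Q.rateMatrix
    (fun i j hij => (Q.visit i).rate_nonneg hij.symm) h
  exact Q.stable_of_drift_neg hv hAv himm

theorem unstable_of_perronEigenvalue_pos (Q : PollingSystem P P') [Nonempty (Fin N)]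
    (hirr : IsIrreducibleMatrix Q.rateMatrix) (hne : Q.NonzeroSwitchInput)
    (h : 0 < perronEigenvalue Q.rateMatrix) : Q.Unstable := by
  obtain ⟨v, hv, hAv⟩ := exists_pos_mulVec_pos_of_perronEigenvalue_pos Q.rateMatrix
    (fun i j hij => (Q.visit i).rate_nonneg hij.symm) hirr h
  exact Q.unstable_of_drift_pos hv hAv hne.exists

lemma IsStandard.sum_rate {Q : PollingSystem P P'} (h : Q.IsStandard) (i : Fin N) :
    ∑ j, (Q.visit i).rate j * (1 : ℝ) = ∑ j, Q.inputRate j - 1 := by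
  simp [h.rate_eq, Finset.sum_sub_distrib, Pi.single_apply]

end PollingSystem

end Polling

theorem corollary7p2 {N : ℕ} (hN : 1 ≤ N) {Ω Ω' : Fin N → Type*}
    [∀ i, MeasurableSpace (Ω i)] [∀ i, MeasurableSpace (Ω' i)]
    {P : ∀ i, Measure (Ω i)} {P' : ∀ i, Measure (Ω' i)}
    [∀ i, IsProbabilityMeasure (P i)] [∀ i, IsProbabilityMeasure (P' i)]
    (Q : Polling.PollingSystem P P') :
    -- stability and instability in terms of the Perron-Frobenius eigenvalue of the rate matrix
    (Polling.IsIrreducibleMatrix Q.rateMatrix → Q.NonzeroSwitchInput →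
      (Polling.perronEigenvalue Q.rateMatrix < 0 → Q.IntegrableImmigration → Q.Stable) ∧
      (0 < Polling.perronEigenvalue Q.rateMatrix → Q.Unstable)) ∧
    -- stability depends on the rates only, not on the disciplines
    (∀ {Ω₂ Ω₂' : Fin N → Type*} [∀ i, MeasurableSpace (Ω₂ i)] [∀ i, MeasurableSpace (Ω₂' i)]
      {P₂ : ∀ i, Measure (Ω₂ i)} {P₂' : ∀ i, Measure (Ω₂' i)}
      [∀ i, IsProbabilityMeasure (P₂ i)] [∀ i, IsProbabilityMeasure (P₂' i)]
      (Q₂ : Polling.PollingSystem P₂ P₂'),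
      Q₂.rateMatrix = Q.rateMatrix → Polling.IsIrreducibleMatrix Q.rateMatrix →
      Polling.perronEigenvalue Q.rateMatrix ≠ 0 →
      Q.NonzeroSwitchInput → Q₂.NonzeroSwitchInput →
      Q.IntegrableImmigration → Q₂.IntegrableImmigration →
      (Q.Stable ↔ Q₂.Stable) ∧ (Q.Unstable ↔ Q₂.Unstable)) ∧
    -- the standard model
    (Q.IsStandard → (∀ j, 0 < Q.inputRate j) →
      (∑ j, Q.inputRate j < 1 → Q.IntegrableImmigration → Q.Stable) ∧
      (1 < ∑ j, Q.inputRate j → Q.Unstable)) := by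
  have : Nonempty (Fin N) := ⟨⟨0, hN⟩⟩
  refine ⟨fun hirr hne => ⟨fun h himm => Q.stable_of_perronEigenvalue_neg h himm,
    fun h => Q.unstable_of_perronEigenvalue_pos hirr hne h⟩, ?_, fun hst hpos => ⟨?_, ?_⟩⟩
  · intro Ω₂ Ω₂' _ _ P₂ P₂' _ _ Q₂ hA hirr hρ hne hne₂ himm himm₂
    rcases lt_or_gt_of_ne hρ with h | h
    · have h1 := Q.stable_of_perronEigenvalue_neg h himm
      have h2 := Q₂.stable_of_perronEigenvalue_neg (hA ▸ h) himm₂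
      exact ⟨iff_of_true h1 h2, iff_of_false h1.not_unstable h2.not_unstable⟩
    · have h1 := Q.unstable_of_perronEigenvalue_pos hirr hne h
      have h2 := Q₂.unstable_of_perronEigenvalue_pos (hA ▸ hirr) hne₂ (hA ▸ h)
      exact ⟨iff_of_false (fun h => h.not_unstable h1) fun h => h.not_unstable h2,
        iff_of_true h1 h2⟩
  · intro hlt himm
    -- With unit weights the drift of the total workload is `ρ - 1` at every queue, so the test
    -- vector is explicit and no eigenvalue is needed.
    refine Q.stable_of_drift_neg (v := fun _ => 1) (fun _ => one_pos) (fun i => ?_) himm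
    rw [hst.sum_rate]
    linarith
  · intro hgt
    refine Q.unstable_of_drift_pos (v := fun _ => 1) (fun _ => one_pos) (fun i => ?_)
      ⟨⟨0, hN⟩, Q.switchInput_ne_zero_of_inputRate_ne_zero (hpos _).ne'⟩
    rw [hst.sum_rate]
    linarith
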